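/- A \emph{mesh} is a plane straight-line graph $M$ with a finite set of vertices, all of whose bounded faces are triangles, such that the interiors of the triangles are disjoint and any two different triangles are disjoint or intersect exactly in a common vertex or a common edge; its \emph{size} is its number of vertices. For $\delta>0$, the mesh is \emph{$\delta$-fat} if every angle of every triangle of $M$ is at least $\delta$. A \emph{carrot} (convex outerplanar polygon that respects $M$) is a convex polygon with nonempty interior whose boundary is a union of edges of $M$ (several collinear edges may form one side) and which has no vertex of $M$ in its interior. Theorem. For every $\delta>0$ there is a constant $C$, depending only on $\delta$, such that every $\delta$-fat mesh $M$ of size $n$ has at most $C\,n^{\lfloor 2\pi/(3\delta)\rfloor}$ carrots; that is, any $\delta$-fat mesh of size $n$ has at most $O\big(n^{\lfloor 2\pi/(3\delta)\rfloor}\big)$ convex outerplanar polygons that respect it. -/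

import Mathlib

namespace MeshCarrots

/-- The Euclidean plane. -/
abbrev Plane : Type := EuclideanSpace ℝ (Fin 2)

/-- A plane straight-line graph: finitely many points of the plane, joined by straight edges such
that no vertex lies in the relative interior of an edge and the relative interiors of any two
different edges are disjoint. -/
structure PlaneGraph where
  /-- the vertices -/
  verts : Finset Plane
  /-- the adjacency relation -/
  graph : SimpleGraph Plane
  mem_verts_of_adj : ∀ a b, graph.Adj a b → a ∈ verts
  notMem_openSegment : ∀ a b v, graph.Adj a b → v ∈ verts → v ∉ openSegment ℝ a b
  disjoint_openSegment : ∀ a b c d, graph.Adj a b → graph.Adj c d → s(a, b) ≠ s(c, d) →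
    Disjoint (openSegment ℝ a b) (openSegment ℝ c d)

namespace PlaneGraph

/-- The edges, as closed segments in the plane. -/
def edgeSegments (G : PlaneGraph) : Set (Set Plane) :=
  {s | ∃ a b, G.graph.Adj a b ∧ s = segment ℝ a b}

/-- The point set covered by the vertices and edges. -/
def drawing (G : PlaneGraph) : Set Plane :=
  (G.verts : Set Plane) ∪ ⋃₀ G.edgeSegments

/-- A bounded face: a bounded connected component of the complement of the drawing. -/
def IsBoundedFace (G : PlaneGraph) (f : Set Plane) : Prop :=
  (∃ x ∈ G.drawingᶜ, f = connectedComponentIn G.drawingᶜ x) ∧ Bornology.IsBounded f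

/-- `t` is the vertex set of a triangle of `G`: three pairwise adjacent vertices whose triangle
has a bounded face of `G` as its interior. -/
def IsTriangle (G : PlaneGraph) (t : Finset Plane) : Prop :=
  t.card = 3 ∧ (∀ a ∈ t, ∀ b ∈ t, a ≠ b → G.graph.Adj a b) ∧
    G.IsBoundedFace (interior (convexHull ℝ (t : Set Plane)))

end PlaneGraph

/-- A mesh: a plane straight-line graph all of whose bounded faces are triangles, such that any
two different triangles meet in the convex hull of their common vertices, i.e. not at all, in a
common vertex, or in a common edge. (That the interiors of two different triangles are disjoint
is automatic, since these are different faces.) -/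
structure Mesh extends PlaneGraph where
  exists_triangle : ∀ f, toPlaneGraph.IsBoundedFace f →
    ∃ t : Finset Plane, toPlaneGraph.IsTriangle t ∧ f = interior (convexHull ℝ (t : Set Plane))
  inter_triangles : ∀ s t : Finset Plane, toPlaneGraph.IsTriangle s → toPlaneGraph.IsTriangle t →
    s ≠ t → convexHull ℝ (s : Set Plane) ∩ convexHull ℝ (t : Set Plane) =
      convexHull ℝ ((s : Set Plane) ∩ (t : Set Plane))

namespace Mesh

/-- The size of a mesh is its number of vertices. -/
def size (M : Mesh) : ℕ := M.verts.card

/-- A mesh is `δ`-fat if every angle of every triangle of it is at least `δ`. -/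
def IsFat (M : Mesh) (δ : ℝ) : Prop :=
  ∀ t, M.IsTriangle t → ∀ a ∈ t, ∀ b ∈ t, ∀ c ∈ t, a ≠ b → b ≠ c → a ≠ c →
    δ ≤ EuclideanGeometry.angle a b c

end Mesh

/-- A (non-degenerate, closed, filled) convex polygon. -/
def IsConvexPolygon (P : Set Plane) : Prop :=
  (∃ s : Finset Plane, P = convexHull ℝ (s : Set Plane)) ∧ (interior P).Nonempty

namespace Mesh

/-- A polygon respects the mesh if its boundary is made up of edges of the mesh. One side of the
polygon may consist of several collinear edges. -/
def Respects (M : Mesh) (P : Set Plane) : Prop :=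
  ∃ F ⊆ M.edgeSegments, frontier P = ⋃₀ F

/-- A carrot: a convex polygon that respects the mesh and is outerplanar, i.e. has no vertex of
the mesh in its interior. -/
def IsCarrot (M : Mesh) (P : Set Plane) : Prop :=
  IsConvexPolygon P ∧ M.Respects P ∧ ∀ v ∈ M.verts, v ∉ interior P

end Mesh

end MeshCarrots

/-!
A carrot `P` is the union of the mesh triangles in it (`Mesh.IsCarrot.eq_iUnion`), and all their
vertices lie on its boundary. Hence a side of such a triangle that is not part of the boundary is a
chord which cuts `P` in two, and has a triangle of `P` on either side
(`Mesh.IsCarrot.exists_adjacent`): the triangles of `P` form a tree. The proof shows that `P` is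
determined, up to boundedly many choices, by at most `⌊2π / (3δ)⌋` of its triangles.

These generators are the leaves of the tree that remains when the leaves of the tree of triangles
are removed. In order to avoid trees, they are described by caps: a cap is cut off by a side of a
triangle of `P` such that both this side and another one are interior, so that there are at least
two triangles in the cap, and the generators are the triangles `abc` at the base `ab` of
inclusion-minimal caps. Call `d` the apex of the triangle on the other side of the second interior
side `bc`. The directions in which `c` or `d` is further out than both `a` and `b` form an arc whose
length is at least three angles of triangles, so at least `3δ` (`Mesh.IsFat.le_angular_capArc`). In
these directions the points of `P` that are furthest out lie in the cap. Since minimal caps do not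
overlap (`Mesh.IsMinCap.beyond`), their arcs are disjoint (`Mesh.IsMinCap.disjoint_capArc`), and as
the arcs have total length at most `2π`, there are at most `2π / (3δ)` generators.

Let `H` be the intersection of all carrots that contain the generators of `P`. It is a convex part
of `P` and contains every mesh triangle that it overlaps. A triangle of `P` outside `H` has a side
`ab` with `H` beyond it. It has no second interior side, because otherwise there would be a minimal
cap on the side of `ab` away from `H` (`Mesh.IsCarrot.not_isCap`). For the same reason the triangle
on the other side of `ab` is in `H`. So `a` is a point of `H`, and convexity of `P` forces a turn of
at least `δ` of the boundary of `H` at `a` (`Mesh.IsCarrot.exists_isCorner`). There are at most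
`2π / δ` such corners `a`, and at most `2π / δ` triangles of the mesh at each of them. So the
triangles of `P` outside `H` are chosen from a set of size at most `(2π / δ)²` that depends only on
the generators. Finally, as there are at most `2π / δ` triangles at a vertex, a mesh of size `n` has
at most `2π n / δ` triangles, from which the generators are chosen.
-/

open Set Metric MeasureTheory

/-! ### Barycentric coordinates in the plane -/

namespace MeshCarrots

/-- Twice the signed area of the triangle `abx`; as a function of `x` it is affine and vanishes
exactly on the line `ab` (when `a ≠ b`). -/
noncomputable def orient (a b x : Plane) : ℝ :=
  (b 0 - a 0) * (x 1 - a 1) - (b 1 - a 1) * (x 0 - a 0)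

/-- The barycentric coordinate of `x` at the vertex `c` of the triangle `abc`: the affine function
which is `0` on the line `ab` and `1` at `c`. It is meaningful only when `orient a b c ≠ 0`. -/
noncomputable def height (a b c x : Plane) : ℝ := orient a b x / orient a b c

theorem plane_ext {x y : Plane} (h0 : x 0 = y 0) (h1 : x 1 = y 1) : x = y := by
  ext i; fin_cases i
  · exact h0
  · exact h1

theorem orient_comb (a b x y : Plane) {s r : ℝ} (h : s + r = 1) :
    orient a b (s • x + r • y) = s * orient a b x + r * orient a b y := by
  obtain rfl : r = 1 - s := by linarith
  simp only [orient, PiLp.add_apply, PiLp.smul_apply, smul_eq_mul]; ring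

theorem height_comb (a b c x y : Plane) {s r : ℝ} (h : s + r = 1) :
    height a b c (s • x + r • y) = s * height a b c x + r * height a b c y := by
  simp only [height, orient_comb a b x y h]; ring

theorem orient_rotate (a b c : Plane) : orient b c a = orient a b c := by
  simp only [orient]; ring

theorem orient_swap (a b c : Plane) : orient b a c = - orient a b c := by
  simp only [orient]; ring

theorem convex_height_mem (a b c : Plane) {D : Set ℝ} (hD : Convex ℝ D) :
    Convex ℝ {x | height a b c x ∈ D} := by
  intro x hx y hy s r hs hr h
  rw [mem_ofPred_eq, height_comb a b c x y h]
  exact hD hx hy hs hr h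

theorem height_swap (a b c x : Plane) : height b a c x = height a b c x := by
  simp only [height, orient_swap a b, neg_div_neg_eq]

theorem height_left (a b c : Plane) : height a b c a = 0 := by
  simp [height, orient]

theorem height_right (a b c : Plane) : height a b c b = 0 := by
  simp only [height, orient]; ring

theorem height_apex {a b c : Plane} (h : orient a b c ≠ 0) : height a b c c = 1 :=
  div_self h

theorem continuous_orient (a b : Plane) : Continuous (orient a b) := by
  unfold orient; fun_prop

theorem continuous_height (a b c : Plane) : Continuous (height a b c) := by
  unfold height; exact (continuous_orient a b).div_const _

theorem height_sum {a b c : Plane} (h : orient a b c ≠ 0) (x : Plane) :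
    height b c a x + height c a b x + height a b c x = 1 := by
  simp only [height, orient_rotate a b c, ← orient_rotate c a b]
  rw [← add_div, ← add_div, div_eq_one_iff_eq h]
  simp only [orient]; ring

theorem eq_barycentric {a b c : Plane} (h : orient a b c ≠ 0) (x : Plane) :
    x = height b c a x • a + height c a b x • b + height a b c x • c := by
  have h1 : orient b c a ≠ 0 := by rwa [orient_rotate]
  have h2 : orient c a b ≠ 0 := by rwa [orient_rotate]
  have e1 := orient_rotate a b c
  have e2 := orient_rotate b c a
  simp only [height, e2, e1]
  apply plane_ext <;>
  · simp only [PiLp.add_apply, PiLp.smul_apply, smul_eq_mul]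
    field_simp
    simp only [orient]; ring

theorem sub_eq_barycentric {a b c : Plane} (h : orient a b c ≠ 0) (x : Plane) :
    x - a = height c a b x • (b - a) + height a b c x • (c - a) := by
  have h1 := eq_barycentric h x
  have h2 : height b c a x = 1 - height c a b x - height a b c x := by
    linarith [height_sum h x]
  rw [h2] at h1
  nth_rw 1 [h1]
  module

theorem convex_three_mem {P : Set Plane} (hP : Convex ℝ P) {a b c : Plane} {r s q : ℝ}
    (hr : 0 ≤ r) (hs : 0 ≤ s) (hq : 0 ≤ q) (h : r + s + q = 1)
    (ha : a ∈ P) (hb : b ∈ P) (hc : c ∈ P) : r • a + s • b + q • c ∈ P := by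
  have := hP.sum_mem (t := Finset.univ) (w := ![r, s, q]) (z := ![a, b, c])
    (by intro i _; fin_cases i <;> simpa) (by simpa [Fin.sum_univ_three])
    (by intro i _; fin_cases i <;> simpa)
  simpa [Fin.sum_univ_three] using this

/-- A point with positive barycentric coordinates lies in the interior of every convex set that
contains the vertices of the triangle. -/
theorem mem_interior_of_height_pos {P : Set Plane} (hP : Convex ℝ P) {a b c x : Plane}
    (h : orient a b c ≠ 0) (ha : a ∈ P) (hb : b ∈ P) (hc : c ∈ P)
    (h1 : 0 < height b c a x) (h2 : 0 < height c a b x) (h3 : 0 < height a b c x) :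
    x ∈ interior P := by
  refine mem_interior.2 ⟨{y | 0 < height b c a y} ∩ {y | 0 < height c a b y} ∩
    {y | 0 < height a b c y}, ?_, ?_, ⟨h1, h2⟩, h3⟩
  · rintro y ⟨⟨y1, y2⟩, y3⟩
    rw [eq_barycentric h y]
    exact convex_three_mem hP y1.le y2.le y3.le (height_sum h y) ha hb hc
  · exact ((isOpen_lt continuous_const (continuous_height _ _ _)).inter
      (isOpen_lt continuous_const (continuous_height _ _ _))).inter
      (isOpen_lt continuous_const (continuous_height _ _ _))

end MeshCarrots

/-! ### Chords of convex sets -/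

namespace MeshCarrots

theorem exists_comb_mem_of_isOpen {U : Set Plane} (hU : IsOpen U) {x : Plane} (hx : x ∈ U)
    (y : Plane) : ∃ s : ℝ, 0 < s ∧ s < 1 ∧ (1 - s) • x + s • y ∈ U := by
  have hc : Continuous fun s : ℝ => (1 - s) • x + s • y := by fun_prop
  have h0 : ∀ᶠ s in nhds (0 : ℝ), (1 - s) • x + s • y ∈ U :=
    hc.continuousAt.eventually_mem (hU.mem_nhds (by simpa using hx))
  obtain ⟨ε, hε, h⟩ := Metric.eventually_nhds_iff.1 h0
  refine ⟨min ε 1 / 2, by positivity, ?_, h ?_⟩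
  · linarith [min_le_right ε 1]
  · have : 0 < min ε 1 := by positivity
    rw [Real.dist_eq, sub_zero, abs_of_pos (by positivity)]
    linarith [min_le_left ε 1]

/-- The triangle `abc` is non-degenerate and its vertices are boundary points of `P` that
belong to `P`. -/
structure Inscribed (P : Set Plane) (a b c : Plane) : Prop where
  orient_ne : orient a b c ≠ 0
  mem₁ : a ∈ P
  mem₂ : b ∈ P
  mem₃ : c ∈ P
  notMem₁ : a ∉ interior P
  notMem₂ : b ∉ interior P
  notMem₃ : c ∉ interior P

namespace Inscribed

variable {P : Set Plane} {a b c : Plane}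

theorem rotate (h : Inscribed P a b c) : Inscribed P b c a :=
  ⟨by rw [orient_rotate]; exact h.1, h.3, h.4, h.2, h.6, h.7, h.5⟩

theorem swap (h : Inscribed P a b c) : Inscribed P b a c :=
  ⟨by rw [orient_swap]; exact neg_ne_zero.2 h.1, h.3, h.2, h.4, h.6, h.5, h.7⟩

/-- A point of `P` opposite to the angle of an inscribed triangle at `c` would put `c` in the
interior of `P`. -/
theorem not_two_neg (h : Inscribed P a b c) (hP : Convex ℝ P) {x : Plane} (hx : x ∈ P)
    (h1 : height b c a x < 0) (h2 : height c a b x < 0) : False := by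
  have h3 : 1 < height a b c x := by linarith [height_sum h.orient_ne x]
  have hO := h.orient_ne
  have e1 := orient_rotate a b c
  have e2 := orient_rotate b c a
  have hx0 : orient a b x = height a b c x * orient a b c := by
    simp only [height]; field_simp
  have hx1 : orient b c x = height b c a x * orient a b c := by
    simp only [height, e1]; field_simp
  have hx2 : orient c a x = height c a b x * orient a b c := by
    simp only [height, e1, e2]; field_simp
  have hne : orient a b x ≠ 0 := by rw [hx0]; exact mul_ne_zero (by linarith) hO
  have f1 : orient b x c = - orient b c x := by simp only [orient]; ring
  have f2 : orient x a c = - orient c a x := by simp only [orient]; ring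
  refine h.notMem₃ (mem_interior_of_height_pos hP hne h.mem₁ h.mem₂ hx ?_ ?_ ?_)
  · rw [height, f1, orient_rotate a b x, hx0, hx1, ← neg_mul, mul_div_mul_right _ _ hO]
    exact div_pos (by linarith) (by linarith)
  · rw [height, f2, orient_rotate b x a, orient_rotate a b x, hx0, hx2, ← neg_mul,
      mul_div_mul_right _ _ hO]
    exact div_pos (by linarith) (by linarith)
  · rw [height, hx0, ← div_div, div_right_comm, div_self hO]
    exact div_pos one_pos (by linarith)

end Inscribed

/-- The centroid of a triangle is an interior point of every convex set that contains the
triangle. -/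
theorem exists_mem_interior_height_eq {a b c : Plane} (h : orient a b c ≠ 0) :
    ∃ g : Plane, height b c a g = 1 / 3 ∧ height c a b g = 1 / 3 ∧ height a b c g = 1 / 3 ∧
      ∀ P : Set Plane, Convex ℝ P → a ∈ P → b ∈ P → c ∈ P → g ∈ interior P := by
  have key : ∀ p q r : Plane, height p q r
      ((1 / 3 : ℝ) • a + (2 / 3 : ℝ) • ((1 / 2 : ℝ) • b + (1 / 2 : ℝ) • c)) =
        (height p q r a + height p q r b + height p q r c) / 3 := by
    intro p q r
    rw [height_comb _ _ _ _ _ (by norm_num), height_comb _ _ _ _ _ (by norm_num)]; ring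
  have h1 : orient b c a ≠ 0 := by rwa [orient_rotate]
  have h2 : orient c a b ≠ 0 := by rwa [orient_rotate]
  have k1 := key b c a
  have k2 := key c a b
  have k3 := key a b c
  rw [height_left, height_right, height_apex h1] at k1
  rw [height_left, height_right, height_apex h2] at k2
  rw [height_left, height_right, height_apex h] at k3
  refine ⟨_, by rw [k1]; norm_num, by rw [k2]; norm_num, by rw [k3]; norm_num, ?_⟩
  intro P hP ha hb hc
  refine mem_interior_of_height_pos hP h ha hb hc ?_ ?_ ?_
  · rw [k1]; norm_num
  · rw [k2]; norm_num
  · rw [k3]; norm_num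

/-- A convex part of `P` which does not overlap an inscribed triangle lies beyond one of the sides
of that triangle. -/
theorem Inscribed.beyond {P K : Set Plane} {a b c : Plane} (h : Inscribed P a b c)
    (hP : Convex ℝ P) (hK : Convex ℝ K) (hKP : K ⊆ P)
    (hd : Disjoint (interior K) (interior (convexHull ℝ {a, b, c}))) :
    (∀ x ∈ interior K, height a b c x < 0) ∨ (∀ x ∈ interior K, height b c a x < 0) ∨
      (∀ x ∈ interior K, height c a b x < 0) := by
  have ha : a ∈ convexHull ℝ {a, b, c} := subset_convexHull ℝ _ (by simp)
  have hb : b ∈ convexHull ℝ {a, b, c} := subset_convexHull ℝ _ (by simp)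
  have hc : c ∈ convexHull ℝ {a, b, c} := subset_convexHull ℝ _ (by simp)
  have hsub : interior K ⊆ P := interior_subset.trans hKP
  have hneg : ∀ x ∈ interior K,
      height a b c x < 0 ∨ height b c a x < 0 ∨ height c a b x < 0 := by
    intro x hx
    by_contra! hcon
    obtain ⟨g, g1, g2, g3, -⟩ := exists_mem_interior_height_eq h.orient_ne
    obtain ⟨s, s0, s1, hs⟩ := exists_comb_mem_of_isOpen isOpen_interior hx g
    refine disjoint_left.1 hd hs (mem_interior_of_height_pos (convex_convexHull ℝ _) h.orient_ne
      ha hb hc ?_ ?_ ?_)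
    · rw [height_comb _ _ _ _ _ (by ring), g1]
      have := mul_nonneg (sub_nonneg.2 s1.le) hcon.2.1
      linarith
    · rw [height_comb _ _ _ _ _ (by ring), g2]
      have := mul_nonneg (sub_nonneg.2 s1.le) hcon.2.2
      linarith
    · rw [height_comb _ _ _ _ _ (by ring), g3]
      have := mul_nonneg (sub_nonneg.2 s1.le) hcon.1
      linarith
  have hpre : IsPreconnected (interior K) := hK.interior.isPreconnected
  have hO : ∀ p q r : Plane, IsOpen {x | height p q r x < 0} := fun p q r =>
    isOpen_lt (continuous_height _ _ _) continuous_const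
  have hne : ∀ {p q r : Plane}, Inscribed P p q r → ∀ x ∈ interior K, height q r p x < 0 →
      height r p q x < 0 → False := fun hi x hx => hi.not_two_neg hP (hsub hx)
  by_cases h1 : ∃ x ∈ interior K, height a b c x < 0
  · left
    obtain ⟨x, hx, hx1⟩ := h1
    by_contra! hcon
    obtain ⟨y, hy, hy1⟩ := hcon
    obtain ⟨z, hz, hz1, hz2⟩ := hpre _ ({x | height b c a x < 0} ∪ {x | height c a b x < 0})
      (hO a b c) ((hO b c a).union (hO c a b)) (fun z hz => hneg z hz) ⟨x, hx, hx1⟩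
      ⟨y, hy, (hneg y hy).resolve_left (not_lt.2 hy1)⟩
    rcases hz2 with hz2 | hz2
    · exact hne h.rotate.rotate z hz hz1 hz2
    · exact hne h.rotate z hz hz2 hz1
  · right
    push Not at h1
    by_contra! hcon
    obtain ⟨⟨x, hx, hx1⟩, y, hy, hy1⟩ := hcon
    have hneg' := fun z hz => (hneg z hz).resolve_left (not_lt.2 (h1 z hz))
    obtain ⟨z, hz, hz1, hz2⟩ := hpre _ _ (hO b c a) (hO c a b) hneg'
      ⟨y, hy, (hneg' y hy).resolve_right (not_lt.2 hy1)⟩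
      ⟨x, hx, (hneg' x hx).resolve_left (not_lt.2 hx1)⟩
    exact hne h z hz hz1 hz2

/-- The open segment `ab` passes through the interior of `P`. -/
def InteriorEdge (P : Set Plane) (a b : Plane) : Prop :=
  (openSegment ℝ a b ∩ interior P).Nonempty

theorem InteriorEdge.symm {P : Set Plane} {a b : Plane} (h : InteriorEdge P a b) :
    InteriorEdge P b a := by
  rwa [InteriorEdge, openSegment_symm]

theorem exists_eq_comb_of_orient_eq_zero {a b x : Plane} (hab : a ≠ b) (h : orient a b x = 0) :
    ∃ t : ℝ, x = (1 - t) • a + t • b := by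
  have hpos : (b 0 - a 0) ^ 2 + (b 1 - a 1) ^ 2 ≠ 0 := by
    intro h0
    apply hab
    have h1 : b 0 - a 0 = 0 := by nlinarith [sq_nonneg (b 0 - a 0), sq_nonneg (b 1 - a 1)]
    have h2 : b 1 - a 1 = 0 := by nlinarith [sq_nonneg (b 0 - a 0), sq_nonneg (b 1 - a 1)]
    exact plane_ext (by linarith) (by linarith)
  refine ⟨((b 0 - a 0) * (x 0 - a 0) + (b 1 - a 1) * (x 1 - a 1)) /
    ((b 0 - a 0) ^ 2 + (b 1 - a 1) ^ 2), ?_⟩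
  simp only [orient] at h
  apply plane_ext <;>
  · simp only [PiLp.add_apply, PiLp.smul_apply, smul_eq_mul]
    field_simp
    first
    | linear_combination (-(b 1 - a 1)) * h
    | linear_combination (b 0 - a 0) * h

/-- If the segment `ab` between two boundary points passes through the interior of a convex set,
then the line `ab` meets the convex set in this segment only. -/
theorem InteriorEdge.mem_segment {P : Set Plane} {a b x : Plane} (h : InteriorEdge P a b)
    (hP : Convex ℝ P) (ha : a ∉ interior P) (hb : b ∉ interior P) (hx : x ∈ P)
    (h0 : orient a b x = 0) : x ∈ segment ℝ a b := by
  obtain ⟨z, ⟨r, s, hr, hs, hrs, rfl⟩, hz⟩ := h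
  obtain rfl : r = 1 - s := by linarith
  have hab : a ≠ b := by
    rintro rfl
    apply ha
    rwa [← add_smul, hrs, one_smul] at hz
  obtain ⟨t, rfl⟩ := exists_eq_comb_of_orient_eq_zero hab h0
  rcases lt_or_ge t 0 with ht | ht
  · exfalso
    apply ha
    apply hP.openSegment_interior_self_subset_interior hz hx
    refine ⟨-t / (s - t), s / (s - t), div_pos (by linarith) (by linarith),
      div_pos hs (by linarith), ?_, ?_⟩
    · rw [← add_div, div_eq_one_iff_eq (by linarith)]; ring
    · have : s - t ≠ 0 := by linarith
      match_scalars <;> (field_simp; ring)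
  rcases lt_or_ge 1 t with ht' | ht'
  · exfalso
    apply hb
    apply hP.openSegment_interior_self_subset_interior hz hx
    refine ⟨(t - 1) / (t - s), (1 - s) / (t - s), div_pos (by linarith) (by linarith),
      div_pos hr (by linarith), ?_, ?_⟩
    · rw [← add_div, div_eq_one_iff_eq (by linarith)]; ring
    · have : t - s ≠ 0 := by linarith
      match_scalars <;> (field_simp; ring)
  exact ⟨1 - t, t, by linarith, ht, by ring, rfl⟩

/-- A side of an inscribed triangle with interior points of `P` beyond it is not part of the
boundary of `P`. -/
theorem Inscribed.interiorEdge {P : Set Plane} {a b c k : Plane} (h : Inscribed P a b c)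
    (hP : Convex ℝ P) (hk : k ∈ interior P) (hneg : height a b c k < 0) : InteriorEdge P a b := by
  set m := height a b c k with hm
  have hd : 0 < 1 - m := by linarith
  have hab : a ≠ b := by
    rintro rfl
    apply h.orient_ne
    simp [orient]
  -- the point where the segment from `c` to `k` crosses the line `ab`
  have hz : (-m / (1 - m)) • c + (1 / (1 - m)) • k ∈ interior P := by
    apply hP.openSegment_self_interior_subset_interior h.mem₃ hk
    refine ⟨_, _, div_pos (by linarith) hd, div_pos one_pos hd, ?_, rfl⟩
    rw [← add_div, div_eq_one_iff_eq hd.ne']; ring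
  have h0 : height a b c ((-m / (1 - m)) • c + (1 / (1 - m)) • k) = 0 := by
    rw [height_comb _ _ _ _ _ (by rw [← add_div, div_eq_one_iff_eq hd.ne']; ring),
      height_apex h.orient_ne, ← hm]
    field_simp; ring
  generalize (-m / (1 - m)) • c + (1 / (1 - m)) • k = z at hz h0
  have h0' : orient a b z = 0 := (div_eq_zero_iff.1 h0).resolve_right h.orient_ne
  refine ⟨z, ?_, hz⟩
  obtain ⟨t, rfl⟩ := exists_eq_comb_of_orient_eq_zero hab h0'
  rcases le_or_gt t 0 with ht | ht
  · exfalso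
    rcases ht.eq_or_lt with rfl | ht
    · exact h.notMem₁ (by simpa using hz)
    apply h.notMem₁
    apply hP.openSegment_interior_self_subset_interior hz h.mem₂
    refine ⟨1 / (1 - t), -t / (1 - t), div_pos one_pos (by linarith),
      div_pos (by linarith) (by linarith), ?_, ?_⟩
    · rw [← add_div, div_eq_one_iff_eq (by linarith)]; ring
    · have : 1 - t ≠ 0 := by linarith
      match_scalars <;> field_simp
      ring
  rcases le_or_gt 1 t with ht' | ht'
  · exfalso
    rcases ht'.eq_or_lt with rfl | ht'
    · exact h.notMem₂ (by simpa using hz)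
    apply h.notMem₂
    apply hP.openSegment_interior_self_subset_interior hz h.mem₁
    refine ⟨1 / t, (t - 1) / t, div_pos one_pos ht, div_pos (by linarith) ht, ?_, ?_⟩
    · rw [← add_div, div_eq_one_iff_eq (by linarith)]; ring
    · match_scalars <;> field_simp
      ring
  exact ⟨1 - t, t, by linarith, ht, by ring, rfl⟩

theorem exists_comb_height_eq_zero {a b c x y : Plane} (hx : height a b c x < 0)
    (hy : 0 ≤ height a b c y) :
    ∃ s r : ℝ, 0 ≤ s ∧ 0 < r ∧ s + r = 1 ∧ height a b c (s • x + r • y) = 0 := by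
  have hd : 0 < height a b c y - height a b c x := by linarith
  refine ⟨height a b c y / (height a b c y - height a b c x),
    -height a b c x / (height a b c y - height a b c x), div_nonneg hy hd.le,
    div_pos (by linarith) hd, ?_, ?_⟩
  · rw [← add_div, div_eq_one_iff_eq hd.ne']; ring
  · rw [height_comb]
    · field_simp; ring
    · rw [← add_div, div_eq_one_iff_eq hd.ne']; ring

/-- Two chords of `P` that do not cross are nested: if the chord `pq` lies outside a half-plane,
and the half-plane contains a point `z` of `P` beyond `pq`, then the part of `P` in the
half-plane lies entirely beyond `pq`. -/
theorem InteriorEdge.nested {P : Set Plane} {p q r a b c x z : Plane} (h : InteriorEdge P p q)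
    (hi : Inscribed P p q r) (hP : Convex ℝ P) (hz : z ∈ P) (hz1 : height p q r z < 0)
    (hz2 : 0 < height a b c z) (hp : height a b c p ≤ 0) (hq : height a b c q ≤ 0)
    (hx : x ∈ P) (hx' : 0 ≤ height a b c x) : height p q r x ≤ 0 := by
  by_contra! hcon
  obtain ⟨s, t, hs, ht, hst, h0⟩ := exists_comb_height_eq_zero hz1 hcon.le
  have hs' : s ≠ 0 := by
    rintro rfl
    obtain rfl : t = 1 := by linarith
    simp only [zero_smul, one_smul, zero_add] at h0
    linarith
  have hmem := h.mem_segment hP hi.notMem₁ hi.notMem₂ (hP hz hx hs ht.le hst)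
    ((div_eq_zero_iff.1 h0).resolve_right hi.orient_ne)
  obtain ⟨u, v, hu, hv, huv, he⟩ := hmem
  have e1 := height_comb a b c p q huv
  have e2 := height_comb a b c z x hst
  rw [he, e2] at e1
  have := mul_pos (lt_of_le_of_ne hs hs'.symm) hz2
  nlinarith [mul_nonneg ht.le hx', mul_nonneg hu (neg_nonneg.2 hp), mul_nonneg hv (neg_nonneg.2 hq)]

/-- A linear functional that is larger at a point `x` of `P` than at the ends of a chord `pq` is
smaller than at `x` on the part of `P` on the other side of the chord. -/
theorem InteriorEdge.inner_lt {P : Set Plane} {p q r x y u : Plane} (h : InteriorEdge P p q)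
    (hi : Inscribed P p q r) (hP : Convex ℝ P) (hx : x ∈ P) (hy : y ∈ P)
    (hx' : 0 ≤ height p q r x) (hy' : height p q r y ≤ 0)
    (hup : inner ℝ u p < inner ℝ u x) (huq : inner ℝ u q < inner ℝ u x) :
    inner ℝ u y < inner ℝ u x := by
  by_contra! hcon
  have hex : ∃ s t : ℝ, 0 ≤ s ∧ 0 ≤ t ∧ s + t = 1 ∧ height p q r (s • y + t • x) = 0 := by
    rcases hy'.eq_or_lt with h0 | h0
    · exact ⟨1, 0, by norm_num, by norm_num, by norm_num, by simpa using h0⟩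
    · obtain ⟨s, t, hs, ht, hst, h0⟩ := exists_comb_height_eq_zero h0 hx'
      exact ⟨s, t, hs, ht.le, hst, h0⟩
  obtain ⟨s, t, hs, ht, hst, h0⟩ := hex
  obtain ⟨v, w, hv, hw, hvw, he⟩ := h.mem_segment hP hi.notMem₁ hi.notMem₂ (hP hy hx hs ht hst)
    ((div_eq_zero_iff.1 h0).resolve_right hi.orient_ne)
  have e := congrArg (fun z => inner ℝ u z) he
  simp only [inner_add_right, inner_smul_right] at e
  have h1 : v * inner ℝ u p + w * inner ℝ u q < inner ℝ u x := by
    have e1 : inner ℝ u x = v * inner ℝ u x + w * inner ℝ u x := by rw [← add_mul, hvw, one_mul]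
    rw [e1]
    rcases hv.eq_or_lt with rfl | hv
    · obtain rfl : w = 1 := by linarith
      linarith
    · nlinarith [mul_lt_mul_of_pos_left hup hv, mul_le_mul_of_nonneg_left huq.le hw]
  have e2 : inner ℝ u x = s * inner ℝ u x + t * inner ℝ u x := by rw [← add_mul, hst, one_mul]
  linarith [mul_le_mul_of_nonneg_left hcon hs]

end MeshCarrots

/-! ### The angular measure of cones -/

namespace MeshCarrots

/-- The unit vector in direction `θ`. -/
noncomputable def direction (θ : ℝ) : Plane := !₂[Real.cos θ, Real.sin θ]

theorem continuous_direction : Continuous direction := by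
  unfold direction; fun_prop

/-- The measure on the plane that gives a cone its opening angle. -/
noncomputable def angular : Measure Plane :=
  (volume.restrict (Ioc (-Real.pi) Real.pi)).map direction

theorem angular_univ : angular univ = ENNReal.ofReal (2 * Real.pi) := by
  rw [angular, Measure.map_apply continuous_direction.measurable MeasurableSet.univ]
  rw [preimage_univ, Measure.restrict_apply_univ, Real.volume_Ioc]; ring_nf

theorem angular_apply {S : Set Plane} (hS : IsOpen S) :
    angular S = volume (direction ⁻¹' S ∩ Ioc (-Real.pi) Real.pi) := by
  rw [angular, Measure.map_apply continuous_direction.measurable hS.measurableSet,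
    Measure.restrict_apply (continuous_direction.measurable hS.measurableSet)]

/-- The angular measure may be computed on any period of the direction angle. -/
theorem angular_apply_of_shift {S : Set Plane} (hS : IsOpen S) (φ : ℝ) :
    angular S = volume (direction ⁻¹' S ∩ Ioc φ (φ + 2 * Real.pi)) := by
  have hpi : 0 < 2 * Real.pi := by positivity
  have h1 := isAddFundamentalDomain_Ioc hpi (-Real.pi)
  have h2 := isAddFundamentalDomain_Ioc hpi φ
  rw [angular_apply hS]
  have := h1.measure_set_eq h2 (A := direction ⁻¹' S)
    (continuous_direction.measurable hS.measurableSet) ?_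
  · rw [← this]; ring_nf
  · rintro ⟨g, hg⟩
    obtain ⟨n, rfl⟩ := AddSubgroup.mem_zmultiples_iff.1 hg
    ext x
    simp only [mem_preimage]
    have : direction ((⟨n • (2 * Real.pi), hg⟩ : AddSubgroup.zmultiples (2 * Real.pi)) +ᵥ x) =
        direction x := by
      change direction (n • (2 * Real.pi) + x) = _
      simp only [direction, zsmul_eq_mul, add_comm _ x, Real.cos_add_int_mul_two_pi,
        Real.sin_add_int_mul_two_pi]
    rw [this]

theorem exists_polar (x : Plane) : ∃ φ : ℝ, x = ‖x‖ • direction φ := by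
  refine ⟨Complex.arg ⟨x 0, x 1⟩, ?_⟩
  have hn : ‖x‖ = ‖(⟨x 0, x 1⟩ : ℂ)‖ := by
    rw [EuclideanSpace.norm_eq, Complex.norm_eq_sqrt_sq_add_sq]
    simp
  rw [hn]
  apply plane_ext
  · simp [direction, Complex.norm_mul_cos_arg]
  · simp [direction, Complex.norm_mul_sin_arg]

theorem inner_direction (φ ψ : ℝ) : inner ℝ (direction φ) (direction ψ) = Real.cos (φ - ψ) := by
  simp [direction, PiLp.inner_apply, Fin.sum_univ_two, Real.cos_sub]; ring

theorem isOpen_wedge (x y : Plane) : IsOpen {u : Plane | 0 < inner ℝ u x ∧ 0 < inner ℝ u y} :=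
  IsOpen.inter (isOpen_lt (f := fun _ : Plane => (0 : ℝ)) (g := fun u => inner ℝ u x)
    (by fun_prop) (by fun_prop))
    (isOpen_lt (f := fun _ : Plane => (0 : ℝ)) (g := fun u => inner ℝ u y)
    (by fun_prop) (by fun_prop))

/-- The directions that make an acute angle with both `x` and `y` form an arc of length
`π - ∠ x y`. -/
theorem le_angular_wedge {x y : Plane} (hx : x ≠ 0) (hy : y ≠ 0) :
    ENNReal.ofReal (Real.pi - InnerProductGeometry.angle x y) ≤
      angular {u | 0 < inner ℝ u x ∧ 0 < inner ℝ u y} := by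
  obtain ⟨φ, hφ⟩ := exists_polar x
  obtain ⟨ψ, hψ⟩ := exists_polar y
  set α := InnerProductGeometry.angle x y with hα
  have hα0 : 0 ≤ α := InnerProductGeometry.angle_nonneg x y
  have hα1 : α ≤ Real.pi := InnerProductGeometry.angle_le_pi x y
  have nx : 0 < ‖x‖ := norm_pos_iff.2 hx
  have ny : 0 < ‖y‖ := norm_pos_iff.2 hy
  have hcos : Real.cos α = Real.cos (ψ - φ) := by
    have h1 := InnerProductGeometry.cos_angle_mul_norm_mul_norm x y
    rw [← hα] at h1
    have h0 : inner ℝ x y = inner ℝ (‖x‖ • direction φ) (‖y‖ • direction ψ) := by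
      rw [← hφ, ← hψ]
    rw [h0, inner_smul_left, inner_smul_right, inner_direction] at h1
    simp only [conj_trivial] at h1
    have : ‖x‖ * ‖y‖ ≠ 0 := by positivity
    have h2 : Real.cos α * (‖x‖ * ‖y‖) = Real.cos (φ - ψ) * (‖x‖ * ‖y‖) := by rw [h1]; ring
    rw [mul_right_cancel₀ this h2, ← Real.cos_neg, neg_sub]
  have hmem : ∀ θ : ℝ, direction θ ∈ {u : Plane | 0 < inner ℝ u x ∧ 0 < inner ℝ u y} ↔
      0 < Real.cos (θ - φ) ∧ 0 < Real.cos (θ - ψ) := by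
    intro θ
    simp only [mem_ofPred_eq]
    rw [hφ, hψ, inner_smul_right, inner_smul_right, inner_direction, inner_direction,
      mul_pos_iff_of_pos_left nx, mul_pos_iff_of_pos_left ny]
  rw [angular_apply_of_shift (isOpen_wedge x y) (φ - Real.pi)]
  obtain ⟨k, hk | hk⟩ := Real.cos_eq_cos_iff.1 hcos
  · have hc : ∀ θ, Real.cos (θ - ψ) = Real.cos (θ - (φ + α)) := by
      intro θ
      rw [show θ - ψ = θ - (φ + α) - k * (2 * Real.pi) by linarith, Real.cos_sub_int_mul_two_pi]
    calc ENNReal.ofReal (Real.pi - α)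
        = volume (Ioo (φ + α - Real.pi / 2) (φ + Real.pi / 2)) := by
          rw [Real.volume_Ioo]; ring_nf
      _ ≤ _ := by
        apply measure_mono
        rintro θ ⟨h1, h2⟩
        refine ⟨(hmem θ).2 ⟨?_, ?_⟩, by linarith, by linarith⟩
        · exact Real.cos_pos_of_mem_Ioo ⟨by linarith, by linarith⟩
        · rw [hc]
          exact Real.cos_pos_of_mem_Ioo ⟨by linarith, by linarith⟩
  · have hc : ∀ θ, Real.cos (θ - ψ) = Real.cos (θ - (φ - α)) := by
      intro θ
      rw [show θ - ψ = θ - (φ - α) - k * (2 * Real.pi) by linarith, Real.cos_sub_int_mul_two_pi]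
    calc ENNReal.ofReal (Real.pi - α)
        = volume (Ioo (φ - Real.pi / 2) (φ - α + Real.pi / 2)) := by
          rw [Real.volume_Ioo]; ring_nf
      _ ≤ _ := by
        apply measure_mono
        rintro θ ⟨h1, h2⟩
        refine ⟨(hmem θ).2 ⟨?_, ?_⟩, by linarith, by linarith⟩
        · exact Real.cos_pos_of_mem_Ioo ⟨by linarith, by linarith⟩
        · rw [hc]
          exact Real.cos_pos_of_mem_Ioo ⟨by linarith, by linarith⟩

/-- Disjoint open sets of directions, each of angular measure at least `r`, number at most
`2π / r`. -/
theorem card_mul_le_of_disjoint_arcs {ι : Type*} (I : Finset ι) (S : ι → Set Plane) {r : ℝ}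
    (hS : ∀ i ∈ I, IsOpen (S i)) (hle : ∀ i ∈ I, ENNReal.ofReal r ≤ angular (S i))
    (hd : ∀ i ∈ I, ∀ j ∈ I, i ≠ j → Disjoint (S i) (S j)) : I.card * r ≤ 2 * Real.pi := by
  have h1 : ∑ i ∈ I, angular (S i) ≤ angular univ := by
    rw [← measure_biUnion_finset (fun i hi j hj hij => hd i hi j hj hij)
      fun i hi => (hS i hi).measurableSet]
    exact measure_mono (subset_univ _)
  have h2 : ENNReal.ofReal (I.card * r) ≤ ENNReal.ofReal (2 * Real.pi) := by
    rw [← angular_univ]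
    refine le_trans ?_ h1
    rw [ENNReal.ofReal_mul (by positivity), ENNReal.ofReal_natCast, ← nsmul_eq_mul]
    exact Finset.card_nsmul_le_sum _ _ _ hle
  exact (ENNReal.ofReal_le_ofReal_iff (by positivity)).1 h2

end MeshCarrots

/-! ### Triangles in a carrot -/

namespace MeshCarrots

theorem PlaneGraph.finite_edgeSegments (G : PlaneGraph) : G.edgeSegments.Finite := by
  refine ((G.verts.finite_toSet.prod G.verts.finite_toSet).image
    fun p : Plane × Plane => segment ℝ p.1 p.2).subset ?_
  rintro s ⟨a, b, hab, rfl⟩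
  exact ⟨(a, b), ⟨G.mem_verts_of_adj a b hab, G.mem_verts_of_adj b a hab.symm⟩, rfl⟩

theorem line_ne_top (a b : Plane) : line[ℝ, a, b] ≠ ⊤ := by
  intro htop
  have h1 := collinear_iff_finrank_le_one.1 (collinear_pair ℝ a b)
  rw [← direction_affineSpan, htop, AffineSubspace.direction_top, finrank_top] at h1
  simp at h1

theorem volume_segment (a b : Plane) : volume (segment ℝ a b) = 0 := by
  rw [← convexHull_pair]
  exact measure_mono_null (convexHull_subset_affineSpan _)
    (Measure.addHaar_affineSubspace volume _ (line_ne_top a b))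

theorem PlaneGraph.volume_drawing (G : PlaneGraph) : volume G.drawing = 0 := by
  rw [drawing, measure_union_null_iff]
  refine ⟨G.verts.finite_toSet.measure_zero _,
    (measure_sUnion_null_iff G.finite_edgeSegments.countable).2 ?_⟩
  rintro s ⟨a, b, -, rfl⟩
  exact volume_segment a b

namespace PlaneGraph.IsTriangle

variable {G : PlaneGraph} {t : Finset Plane}

theorem nonempty_interior (ht : G.IsTriangle t) :
    (interior (convexHull ℝ (t : Set Plane))).Nonempty := by
  obtain ⟨-, -, ⟨x, hx, hf⟩, -⟩ := ht
  rw [hf]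
  exact ⟨x, mem_connectedComponentIn hx⟩

theorem disjoint_drawing (ht : G.IsTriangle t) :
    Disjoint (interior (convexHull ℝ (t : Set Plane))) G.drawing := by
  obtain ⟨-, -, ⟨x, hx, hf⟩, -⟩ := ht
  rw [hf]
  exact disjoint_left.2 fun y hy => connectedComponentIn_subset _ _ hy

theorem subset_verts (ht : G.IsTriangle t) : t ⊆ G.verts := by
  intro a ha
  obtain ⟨b, hb, hba⟩ := Finset.exists_mem_ne (by rw [ht.1]; norm_num) a
  exact G.mem_verts_of_adj a b (ht.2.1 a ha b hb hba.symm)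

theorem exists_coe_eq (ht : G.IsTriangle t) : ∃ a b c, (t : Set Plane) = {a, b, c} := by
  classical
  obtain ⟨a, b, c, -, -, -, rfl⟩ := Finset.card_eq_three.1 ht.1
  exact ⟨a, b, c, by simp⟩

theorem ne_of_coe_eq (ht : G.IsTriangle t) {a b c : Plane} (h : (t : Set Plane) = {a, b, c}) :
    a ≠ b ∧ b ≠ c ∧ a ≠ c := by
  classical
  have h3 : ({a, b, c} : Finset Plane).card = 3 := by
    rw [← ht.1]; congr; apply Finset.coe_injective; simp [h]
  refine ⟨?_, ?_, ?_⟩ <;> rintro rfl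
  · rw [Finset.insert_eq_of_mem (by simp)] at h3
    have := Finset.card_le_two (a := a) (b := c)
    omega
  · rw [Finset.insert_eq_of_mem (a := b) (by simp)] at h3
    have := Finset.card_le_two (a := a) (b := b)
    omega
  · rw [Finset.insert_eq_of_mem (by simp)] at h3
    have := Finset.card_le_two (a := b) (b := a)
    omega

theorem orient_ne (ht : G.IsTriangle t) {a b c : Plane} (h : (t : Set Plane) = {a, b, c}) :
    orient a b c ≠ 0 := by
  intro h0
  have hsub : (t : Set Plane) ⊆ (line[ℝ, a, b] : Set Plane) := by
    rw [h]
    rintro x (rfl | rfl | rfl)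
    · exact left_mem_affineSpan_pair ℝ _ _
    · exact right_mem_affineSpan_pair ℝ _ _
    · obtain ⟨s, hs⟩ := exists_eq_comb_of_orient_eq_zero (ht.ne_of_coe_eq h).1 h0
      rw [hs, ← AffineMap.lineMap_apply_module]
      exact AffineMap.lineMap_mem_affineSpan_pair _ _ _
  have h1 := interior_convexHull_nonempty_iff_affineSpan_eq_top.1 ht.nonempty_interior
  exact line_ne_top a b (top_le_iff.1 (h1 ▸ affineSpan_le.2 hsub))

end PlaneGraph.IsTriangle

namespace Mesh

variable {M : Mesh} {s t : Finset Plane} {P : Set Plane}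

theorem disjoint_interior_triangles (hs : M.IsTriangle s) (ht : M.IsTriangle t) (hst : s ≠ t) :
    Disjoint (interior (convexHull ℝ (s : Set Plane)))
      (interior (convexHull ℝ (t : Set Plane))) := by
  rw [disjoint_iff_inter_eq_empty, ← interior_inter, M.inter_triangles s t hs ht hst]
  by_contra hne
  have h1 := interior_convexHull_nonempty_iff_affineSpan_eq_top.1 (nonempty_iff_ne_empty.2 hne)
  have hline : ∀ a b, ¬ (s : Set Plane) ∩ t ⊆ {a, b} := fun a b h =>
    line_ne_top a b (top_le_iff.1 (h1 ▸ affineSpan_mono ℝ h))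
  obtain ⟨x, hxs, hxt⟩ : ∃ x ∈ s, x ∉ t := by
    by_contra! hcon
    exact hst (Finset.eq_of_subset_of_card_le hcon (by rw [hs.1, ht.1]))
  obtain ⟨a, b, c, habc⟩ := PlaneGraph.IsTriangle.exists_coe_eq hs
  have hx : x ∈ ({a, b, c} : Set Plane) := habc ▸ hxs
  rw [habc] at hline
  rcases hx with rfl | rfl | rfl
  · refine hline b c ?_
    rintro y ⟨rfl | hy, hyt⟩
    exacts [absurd hyt hxt, hy]
  · refine hline a c ?_
    rintro y ⟨rfl | rfl | hy, hyt⟩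
    exacts [.inl rfl, absurd hyt hxt, .inr hy]
  · refine hline a b ?_
    rintro y ⟨rfl | rfl | rfl, hyt⟩
    exacts [.inl rfl, .inr rfl, absurd hyt hxt]

theorem IsCarrot.convex (hP : M.IsCarrot P) : Convex ℝ P := by
  obtain ⟨⟨⟨s, rfl⟩, -⟩, -⟩ := hP
  exact convex_convexHull ℝ _

theorem IsCarrot.isCompact (hP : M.IsCarrot P) : IsCompact P := by
  obtain ⟨⟨⟨s, rfl⟩, -⟩, -⟩ := hP
  exact s.finite_toSet.isCompact_convexHull ℝ

theorem IsCarrot.frontier_subset (hP : M.IsCarrot P) : frontier P ⊆ M.drawing := by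
  obtain ⟨-, ⟨F, hF, h⟩, -⟩ := hP
  rw [h]
  exact (sUnion_subset_sUnion hF).trans subset_union_right

theorem IsCarrot.subset_interior_of_isPreconnected (hP : M.IsCarrot P) {U : Set Plane}
    (hU : IsPreconnected U) (hd : Disjoint U M.drawing) (hne : (U ∩ interior P).Nonempty) :
    U ⊆ interior P := by
  have hfr : Disjoint U (frontier P) := hd.mono_right hP.frontier_subset
  refine hU.subset_left_of_subset_union isOpen_interior isClosed_closure.isOpen_compl
    (disjoint_compl_right.mono_left (interior_subset.trans subset_closure)) ?_ hne
  intro x hx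
  by_contra! hcon
  rw [mem_union, not_or, notMem_compl_iff] at hcon
  exact disjoint_left.1 hfr hx ⟨hcon.2, hcon.1⟩

/-- The triangles of the mesh that are contained in `P`. -/
def trianglesIn (M : Mesh) (P : Set Plane) : Set (Finset Plane) :=
  {t | M.IsTriangle t ∧ (t : Set Plane) ⊆ P}

theorem finite_trianglesIn (M : Mesh) (P : Set Plane) : (M.trianglesIn P).Finite :=
  M.verts.powerset.finite_toSet.subset fun _ ht => by
    simpa using PlaneGraph.IsTriangle.subset_verts ht.1

theorem IsCarrot.subset_of_overlap (hP : M.IsCarrot P) (ht : M.IsTriangle t)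
    (h : (interior (convexHull ℝ (t : Set Plane)) ∩ interior P).Nonempty) :
    (t : Set Plane) ⊆ P := by
  have h1 := hP.subset_interior_of_isPreconnected
    (convex_convexHull ℝ _).interior.isPreconnected
    (PlaneGraph.IsTriangle.disjoint_drawing ht) h
  have h2 := closure_mono (h1.trans interior_subset)
  rw [hP.isCompact.isClosed.closure_eq,
    (convex_convexHull ℝ _).closure_interior_eq_closure_of_nonempty_interior
      (PlaneGraph.IsTriangle.nonempty_interior ht)] at h2
  exact (subset_convexHull ℝ _).trans (subset_closure.trans h2)

/-- A carrot is the union of the mesh triangles in it: off the drawing, a point of its interior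
lies in a face that cannot leave the carrot, hence in a bounded one. -/
theorem IsCarrot.eq_iUnion (hP : M.IsCarrot P) :
    P = ⋃ t ∈ M.trianglesIn P, convexHull ℝ (t : Set Plane) := by
  apply Subset.antisymm
  · have hcl : IsClosed (⋃ t ∈ M.trianglesIn P, convexHull ℝ (t : Set Plane)) :=
      (M.finite_trianglesIn P).isClosed_biUnion fun t _ =>
        (t.finite_toSet.isCompact_convexHull ℝ).isClosed
    have hsub : interior P ∩ M.drawingᶜ ⊆
        ⋃ t ∈ M.trianglesIn P, convexHull ℝ (t : Set Plane) := by
      rintro x ⟨hxP, hx⟩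
      have h1 : connectedComponentIn M.drawingᶜ x ⊆ interior P :=
        hP.subset_interior_of_isPreconnected isPreconnected_connectedComponentIn
          (disjoint_left.2 fun y hy => connectedComponentIn_subset _ _ hy)
          ⟨x, mem_connectedComponentIn hx, hxP⟩
      have h2 : M.IsBoundedFace (connectedComponentIn M.drawingᶜ x) :=
        ⟨⟨x, hx, rfl⟩, hP.isCompact.isBounded.subset (h1.trans interior_subset)⟩
      obtain ⟨t, ht, hft⟩ := M.exists_triangle _ h2
      have hxt : x ∈ interior (convexHull ℝ (t : Set Plane)) :=
        hft ▸ mem_connectedComponentIn hx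
      exact mem_biUnion (x := t) ⟨ht, hP.subset_of_overlap ht ⟨x, hxt, hxP⟩⟩ (interior_subset hxt)
    have hdense : interior P ⊆ closure (interior P ∩ M.drawingᶜ) := by
      have : Dense M.drawingᶜ := by
        rw [← interior_eq_empty_iff_dense_compl]
        by_contra hne
        exact (isOpen_interior.measure_pos volume (nonempty_iff_ne_empty.2 hne)).ne'
          (measure_mono_null interior_subset M.volume_drawing)
      exact this.open_subset_closure_inter isOpen_interior
    have h3 : closure (interior P) = P := by
      rw [hP.convex.closure_interior_eq_closure_of_nonempty_interior hP.1.2,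
        hP.isCompact.isClosed.closure_eq]
    calc P = closure (interior P) := h3.symm
      _ ⊆ closure (interior P ∩ M.drawingᶜ) := closure_minimal hdense isClosed_closure
      _ ⊆ _ := closure_minimal hsub hcl
  · exact iUnion₂_subset fun t ht => convexHull_min ht.2 hP.convex

theorem IsCarrot.exists_mem_trianglesIn (hP : M.IsCarrot P) : ∃ t, t ∈ M.trianglesIn P := by
  obtain ⟨x, hx⟩ := hP.1.2
  have h := interior_subset hx
  rw [hP.eq_iUnion] at h
  obtain ⟨t, ht, -⟩ := mem_iUnion₂.1 h
  exact ⟨t, ht⟩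

theorem IsCarrot.inscribed (hP : M.IsCarrot P) (ht : t ∈ M.trianglesIn P) {a b c : Plane}
    (h : (t : Set Plane) = {a, b, c}) : Inscribed P a b c := by
  have hv : ∀ x ∈ ({a, b, c} : Set Plane), x ∈ P ∧ x ∉ interior P := by
    intro x hx
    rw [← h] at hx
    exact ⟨ht.2 hx, hP.2.2 x (PlaneGraph.IsTriangle.subset_verts ht.1 hx)⟩
  have ha := hv a (by simp)
  have hb := hv b (by simp)
  have hc := hv c (by simp)
  exact ⟨PlaneGraph.IsTriangle.orient_ne ht.1 h, ha.1, hb.1, hc.1, ha.2, hb.2, hc.2⟩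

/-- Across an interior edge of a triangle of a carrot there is another triangle of the carrot. -/
theorem IsCarrot.exists_adjacent (hP : M.IsCarrot P) (ht : t ∈ M.trianglesIn P) {a b c : Plane}
    (h : (t : Set Plane) = {a, b, c}) (he : InteriorEdge P a b) :
    ∃ s ∈ M.trianglesIn P, ∃ d, (s : Set Plane) = {a, b, d} ∧ height a b c d < 0 := by
  classical
  have hi := hP.inscribed ht h
  obtain ⟨z, hz, hzP⟩ := he
  obtain ⟨r, q, hr, hq, hrq, hzz⟩ := hz
  set B := {s ∈ M.trianglesIn P | z ∉ convexHull ℝ (s : Set Plane)} with hB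
  have hBcl : IsClosed (⋃ s ∈ B, convexHull ℝ (s : Set Plane)) :=
    ((M.finite_trianglesIn P).subset (sep_subset _ _)).isClosed_biUnion fun t _ =>
      (t.finite_toSet.isCompact_convexHull ℝ).isClosed
  have hzU : z ∈ interior P ∩ (⋃ s ∈ B, convexHull ℝ (s : Set Plane))ᶜ := by
    refine ⟨hzP, fun hz => ?_⟩
    obtain ⟨s, hs, hzs⟩ := mem_iUnion₂.1 hz
    exact hs.2 hzs
  -- a point slightly beyond `z`, in the direction of the mirror image of `c` in `a`
  obtain ⟨ε, ε0, -, hw⟩ := exists_comb_mem_of_isOpen (isOpen_interior.inter hBcl.isOpen_compl) hzU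
    ((2 : ℝ) • a + (-1 : ℝ) • c)
  have hwneg : height a b c ((1 - ε) • z + ε • ((2 : ℝ) • a + (-1 : ℝ) • c)) < 0 := by
    rw [height_comb _ _ _ _ _ (by ring), height_comb _ _ _ _ _ (by norm_num), ← hzz,
      height_comb _ _ _ _ _ hrq, height_left, height_right, height_apex hi.orient_ne]
    linarith
  generalize (1 - ε) • z + ε • ((2 : ℝ) • a + (-1 : ℝ) • c) = w at hw hwneg
  have hwP := interior_subset hw.1
  rw [hP.eq_iUnion] at hwP
  obtain ⟨s, hs, hws⟩ := mem_iUnion₂.1 hwP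
  have hzs : z ∈ convexHull ℝ (s : Set Plane) := by
    by_contra hcon
    exact hw.2 (mem_biUnion (x := s) ⟨hs, hcon⟩ hws)
  have hside : ∀ s : Finset Plane, w ∈ convexHull ℝ (s : Set Plane) →
      ∃ x ∈ s, height a b c x < 0 := by
    intro s hws
    by_contra! hcon
    have : w ∈ {x | height a b c x ∈ Ici 0} :=
      convexHull_min (fun x hx => hcon x hx) (convex_height_mem a b c (convex_Ici 0)) hws
    exact absurd hwneg (not_lt.2 this)
  have hst : t ≠ s := by
    rintro rfl
    obtain ⟨x, hx, hxn⟩ := hside t hws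
    have hx' : x ∈ ({a, b, c} : Set Plane) := h ▸ hx
    rcases hx' with rfl | rfl | rfl
    · rw [height_left] at hxn; exact hxn.false
    · rw [height_right] at hxn; exact hxn.false
    · rw [height_apex hi.orient_ne] at hxn; linarith
  have hzt : z ∈ convexHull ℝ (t : Set Plane) := by
    rw [← hzz]
    exact convex_convexHull ℝ _ (subset_convexHull ℝ _ (by simp [h]))
      (subset_convexHull ℝ _ (by simp [h])) hr.le hq.le hrq
  have hzc : z ∈ convexHull ℝ ((t : Set Plane) ∩ (s : Set Plane)) := by
    rw [← M.inter_triangles t s ht.1 hs.1 hst]; exact ⟨hzt, hzs⟩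
  have hzero : ∀ p q r : Plane, (∀ x ∈ (t : Set Plane) ∩ (s : Set Plane), height p q r x = 0) →
      height p q r z = 0 := by
    intro p q r hall
    have : z ∈ {x | height p q r x ∈ ({0} : Set ℝ)} :=
      convexHull_min (fun x hx => hall x hx) (convex_height_mem p q r (convex_singleton 0)) hzc
    exact this
  have has : a ∈ s := by
    by_contra hcon
    have h0 := hzero b c a ?_
    · rw [← hzz, height_comb _ _ _ _ _ hrq, height_apex hi.rotate.orient_ne, height_left] at h0
      linarith
    · rintro x ⟨hx, hxs⟩
      rw [h] at hx
      rcases hx with rfl | rfl | rfl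
      · exact absurd hxs hcon
      · exact height_left _ _ _
      · exact height_right _ _ _
  have hbs : b ∈ s := by
    by_contra hcon
    have h0 := hzero c a b ?_
    · rw [← hzz, height_comb _ _ _ _ _ hrq, height_apex hi.rotate.rotate.orient_ne,
        height_right] at h0
      linarith
    · rintro x ⟨hx, hxs⟩
      rw [h] at hx
      rcases hx with rfl | rfl | rfl
      · exact height_right _ _ _
      · exact absurd hxs hcon
      · exact height_left _ _ _
  obtain ⟨d, hds, hdn⟩ := hside s hws
  have hda : a ≠ d := by rintro rfl; rw [height_left] at hdn; exact hdn.false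
  have hdb : b ≠ d := by rintro rfl; rw [height_right] at hdn; exact hdn.false
  have hab : a ≠ b := by rintro rfl; exact hi.orient_ne (by simp [orient])
  have hsub : ({a, b, d} : Finset Plane) ⊆ s := by
    intro x hx
    simp only [Finset.mem_insert, Finset.mem_singleton] at hx
    rcases hx with rfl | rfl | rfl <;> assumption
  have heq := Finset.eq_of_subset_of_card_le hsub
    (by rw [hs.1.1, Finset.card_eq_three.2 ⟨a, b, d, hab, hda, hdb, rfl⟩])
  exact ⟨s, hs, d, by rw [← heq]; simp, hdn⟩

end Mesh

end MeshCarrots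

/-! ### Minimal caps -/

namespace MeshCarrots

theorem height_nonpos_of_interior {K : Set Plane} (hK : Convex ℝ K) (hne : (interior K).Nonempty)
    {a b c : Plane} (h : ∀ x ∈ interior K, height a b c x < 0) {x : Plane} (hx : x ∈ K) :
    height a b c x ≤ 0 := by
  have h1 : closure (interior K) ⊆ {y | height a b c y ≤ 0} :=
    closure_minimal (fun y hy => (h y hy).le)
      (isClosed_le (continuous_height _ _ _) continuous_const)
  rw [hK.closure_interior_eq_closure_of_nonempty_interior hne] at h1
  exact h1 (subset_closure hx)

theorem height_inv (a b c d : Plane) : height a b d c = (height a b c d)⁻¹ := by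
  simp only [height, inv_div]

/-- The part of `P` behind an interior side `bc` of an inscribed triangle `abc` lies on the same
side of the line `ab` as the triangle. -/
theorem Inscribed.height_nonneg_of_beyond {P : Set Plane} {a b c x : Plane}
    (h : Inscribed P a b c) (hP : Convex ℝ P) (he : InteriorEdge P b c) (hx : x ∈ P)
    (h0 : height b c a x ≤ 0) : 0 ≤ height a b c x := by
  by_contra! hcon
  rcases h0.eq_or_lt with h0 | h0
  · obtain ⟨s, t, hs, ht, hst, rfl⟩ := he.mem_segment hP h.notMem₂ h.notMem₃ hx
      ((div_eq_zero_iff.1 h0).resolve_right h.rotate.orient_ne)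
    rw [height_comb _ _ _ _ _ hst, height_right, height_apex h.orient_ne] at hcon
    linarith
  · exact h.rotate.rotate.not_two_neg hP hx hcon h0

namespace Mesh

variable {M : Mesh} {s t : Finset Plane} {P : Set Plane} {a b c : Plane}

/-- The triangle `t = abc` of the mesh lies in `P`, and its sides `ab` and `bc` pass through the
interior of `P`. It is thought of as cutting off the part of `P` on its side of the chord `ab`,
the cap, which contains `t` and a further triangle at `bc`. -/
structure IsCap (M : Mesh) (P : Set Plane) (t : Finset Plane) (a b c : Plane) : Prop where
  mem : t ∈ M.trianglesIn P
  coe_eq : (t : Set Plane) = {a, b, c}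
  base : InteriorEdge P a b
  side : InteriorEdge P b c

/-- The triangles of the mesh in `P` on the same side of the line `ab` as `c`. -/
def capTriangles (M : Mesh) (P : Set Plane) (a b c : Plane) : Set (Finset Plane) :=
  {s | s ∈ M.trianglesIn P ∧ ∀ x ∈ s, 0 ≤ height a b c x}

/-- A cap that does not contain a smaller cap. -/
def IsMinCap (M : Mesh) (P : Set Plane) (t : Finset Plane) (a b c : Plane) : Prop :=
  M.IsCap P t a b c ∧ ∀ t' a' b' c', M.IsCap P t' a' b' c' →
    M.capTriangles P a' b' c' ⊆ M.capTriangles P a b c →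
      M.capTriangles P a b c ⊆ M.capTriangles P a' b' c'

theorem capTriangles_swap (M : Mesh) (P : Set Plane) (a b c : Plane) :
    M.capTriangles P b a c = M.capTriangles P a b c := by
  simp only [capTriangles, height_swap]

theorem IsCap.exists_isMinCap_subset (h : M.IsCap P t a b c) :
    ∃ t' a' b' c', M.IsMinCap P t' a' b' c' ∧
      M.capTriangles P a' b' c' ⊆ M.capTriangles P a b c := by
  induction hn : (M.capTriangles P a b c).ncard using Nat.strong_induction_on
    generalizing t a b c with
  | _ n ih =>
    by_cases hmin : M.IsMinCap P t a b c
    · exact ⟨t, a, b, c, hmin, Subset.rfl⟩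
    · simp only [IsMinCap, not_and, not_forall] at hmin
      obtain ⟨t', a', b', c', h', hsub, hnot⟩ := hmin h
      have hlt : (M.capTriangles P a' b' c').ncard < n := by
        rw [← hn]
        exact ncard_lt_ncard ⟨hsub, hnot⟩ ((M.finite_trianglesIn P).subset fun _ hs => hs.1)
      obtain ⟨u, p, q, r, hu, hsub'⟩ := ih _ hlt h' rfl
      exact ⟨u, p, q, r, hu, hsub'.trans hsub⟩

theorem IsCap.inscribed (h : M.IsCap P t a b c) (hP : M.IsCarrot P) : Inscribed P a b c :=
  hP.inscribed h.mem h.coe_eq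

/-- Any interior side of the triangle of a cap is the base of a cap of the same triangle. -/
theorem IsCap.reorder (h : M.IsCap P t a b c) {p q r : Plane} (ht : (t : Set Plane) = {p, q, r})
    (he : InteriorEdge P p q) : M.IsCap P t p q r ∨ M.IsCap P t q p r := by
  have hne := PlaneGraph.IsTriangle.ne_of_coe_eq h.mem.1 ht
  have ht' : (t : Set Plane) = {q, p, r} := by rw [ht, insert_comm]
  have hmem : ∀ x ∈ ({p, q, r} : Set Plane), x = a ∨ x = b ∨ x = c := by
    rw [← ht, h.coe_eq]; exact fun x hx => hx
  have hb : b ∈ ({p, q, r} : Set Plane) := by rw [← ht, h.coe_eq]; simp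
  have hedge : ∀ x ∈ ({p, q, r} : Set Plane), x ≠ b → InteriorEdge P b x := by
    intro x hx hxb
    rcases hmem x hx with rfl | rfl | rfl
    exacts [h.base.symm, absurd rfl hxb, h.side]
  rcases hb with rfl | rfl | rfl
  · exact .inr ⟨h.mem, ht', he.symm, hedge r (by simp) hne.2.2.symm⟩
  · exact .inl ⟨h.mem, ht, he, hedge r (by simp) hne.2.1.symm⟩
  · exact .inl ⟨h.mem, ht, he, (hedge q (by simp) hne.2.1).symm⟩

theorem convexHull_subset_of_mem_trianglesIn (hP : M.IsCarrot P) (ht : t ∈ M.trianglesIn P) :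
    convexHull ℝ (t : Set Plane) ⊆ P :=
  convexHull_min ht.2 hP.convex

/-- A convex part of a carrot which does not overlap a triangle of the carrot lies beyond an
interior edge of this triangle. -/
theorem IsCarrot.exists_beyond (hP : M.IsCarrot P) (ht : t ∈ M.trianglesIn P) {K : Set Plane}
    (hK : Convex ℝ K) (hKP : K ⊆ P) (hne : (interior K).Nonempty)
    (hd : Disjoint (interior K) (interior (convexHull ℝ (t : Set Plane)))) :
    ∃ p q r, (t : Set Plane) = {p, q, r} ∧ InteriorEdge P p q ∧
      ∀ x ∈ interior K, height p q r x < 0 := by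
  obtain ⟨a, b, c, h⟩ := PlaneGraph.IsTriangle.exists_coe_eq ht.1
  have hi := hP.inscribed ht h
  obtain ⟨k, hk⟩ := hne
  have hkP := interior_mono hKP hk
  have h' : (t : Set Plane) = {b, c, a} := by rw [h, insert_comm, pair_comm a c]
  have h'' : (t : Set Plane) = {c, a, b} := by rw [h, pair_comm b c, insert_comm]
  rcases hi.beyond hP.convex hK hKP (by rwa [← h]) with hn | hn | hn
  · exact ⟨a, b, c, h, hi.interiorEdge hP.convex hkP (hn k hk), hn⟩
  · exact ⟨b, c, a, h', hi.rotate.interiorEdge hP.convex hkP (hn k hk), hn⟩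
  · exact ⟨c, a, b, h'', hi.rotate.rotate.interiorEdge hP.convex hkP (hn k hk), hn⟩

/-- If another triangle `s` that belongs to a cap lay inside a minimal cap, beyond the side `pq` of
its triangle `t`, then `s` would give a cap that is smaller, since it leaves out `t`. -/
theorem IsMinCap.not_beyond_side (h : M.IsMinCap P t a b c) (hP : M.IsCarrot P) {p q r : Plane}
    (ht : (t : Set Plane) = {p, q, r})
    (hcap : InteriorEdge P p q → ∀ x ∈ P, height p q r x ≤ 0 → 0 ≤ height a b c x)
    {a' b' c' : Plane} (h' : M.IsCap P s a' b' c') (hst : s ≠ t)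
    (hn : ∀ x ∈ interior (convexHull ℝ (s : Set Plane)), height p q r x < 0) : False := by
  have hi := hP.inscribed h.1.mem ht
  have hsP := convexHull_subset_of_mem_trianglesIn hP h'.mem
  have htP := convexHull_subset_of_mem_trianglesIn hP h.1.mem
  have htne := PlaneGraph.IsTriangle.nonempty_interior h.1.mem.1
  obtain ⟨p', q', r', hs, he', hn'⟩ := hP.exists_beyond h'.mem (convex_convexHull ℝ _) htP htne
    (disjoint_interior_triangles h.1.mem.1 h'.mem.1 hst.symm)
  have hi' := hP.inscribed h'.mem hs
  obtain ⟨z, -, -, hz3, hzP⟩ := exists_mem_interior_height_eq hi'.orient_ne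
  have hzs : z ∈ interior (convexHull ℝ (s : Set Plane)) := by
    rw [hs]
    exact hzP _ (convex_convexHull ℝ _) (subset_convexHull ℝ _ (by simp))
      (subset_convexHull ℝ _ (by simp)) (subset_convexHull ℝ _ (by simp))
  have he := hi.interiorEdge hP.convex (interior_mono hsP hzs) (hn z hzs)
  have hnt : ∀ x ∈ t, height p' q' r' x ≤ 0 := fun x hx =>
    height_nonpos_of_interior (convex_convexHull ℝ _) htne hn' (subset_convexHull ℝ _ hx)
  have hpt : p ∈ t := by rw [← Finset.mem_coe, ht]; simp
  have hqt : q ∈ t := by rw [← Finset.mem_coe, ht]; simp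
  have hsub : M.capTriangles P p' q' r' ⊆ M.capTriangles P a b c := by
    rintro u ⟨hu, hux⟩
    refine ⟨hu, fun x hx => hcap he x (hu.2 hx) ?_⟩
    exact he.nested hi hP.convex (hsP (interior_subset hzs)) (hn z hzs) (by rw [hz3]; norm_num)
      (hnt p hpt) (hnt q hqt) (hu.2 hx) (hux x hx)
  have hsub' : M.capTriangles P a b c ⊆ M.capTriangles P p' q' r' := by
    rcases h'.reorder hs he' with hc | hc
    · exact h.2 _ _ _ _ hc hsub
    · rw [← capTriangles_swap M P p' q' r'] at hsub ⊢
      exact h.2 _ _ _ _ hc hsub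
  have htmem : t ∈ M.capTriangles P a b c := by
    refine ⟨h.1.mem, fun x hx => ?_⟩
    rw [← Finset.mem_coe, h.1.coe_eq] at hx
    rcases hx with rfl | rfl | rfl
    · rw [height_left]
    · rw [height_right]
    · rw [height_apex (h.1.inscribed hP).orient_ne]; norm_num
  obtain ⟨y, hy⟩ := htne
  have hy0 : y ∈ {x | height p' q' r' x ∈ Ici 0} :=
    convexHull_min (fun x hx => (hsub' htmem).2 x hx) (convex_height_mem _ _ _ (convex_Ici 0))
      (interior_subset hy)
  exact absurd (hn' y hy) (not_lt.2 hy0)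

/-- The triangle of any cap lies beyond the base of every minimal cap with another triangle. -/
theorem IsMinCap.beyond (h : M.IsMinCap P t a b c) (hP : M.IsCarrot P)
    {a' b' c' : Plane} (h' : M.IsCap P s a' b' c') (hst : s ≠ t) {x : Plane}
    (hx : x ∈ interior (convexHull ℝ (s : Set Plane))) : height a b c x < 0 := by
  have hi := h.1.inscribed hP
  have hd := disjoint_interior_triangles h'.mem.1 h.1.mem.1 hst
  rw [h.1.coe_eq] at hd
  rcases hi.beyond hP.convex (convex_convexHull ℝ _)
    (convexHull_subset_of_mem_trianglesIn hP h'.mem) hd with hn | hn | hn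
  · exact hn x hx
  · refine (h.not_beyond_side hP (p := b) (q := c) (r := a) ?_ ?_ h' hst hn).elim
    · rw [h.1.coe_eq, insert_comm, pair_comm a c]
    · exact fun he x hx => hi.height_nonneg_of_beyond hP.convex he hx
  · refine (h.not_beyond_side hP (p := c) (q := a) (r := b) ?_ ?_ h' hst hn).elim
    · rw [h.1.coe_eq, pair_comm b c, insert_comm]
    · intro he x hx h0
      rw [← height_swap]
      exact hi.swap.height_nonneg_of_beyond hP.convex he.symm hx (by rwa [height_swap])

end Mesh

end MeshCarrots

/-! ### The number of minimal caps -/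

namespace MeshCarrots

namespace Mesh

variable {M : Mesh} {s t : Finset Plane} {P : Set Plane} {a b c d : Plane} {δ : ℝ}

theorem IsFat.le_angle (hF : M.IsFat δ) (ht : M.IsTriangle t)
    (h : (t : Set Plane) = {a, b, c}) : δ ≤ EuclideanGeometry.angle a b c := by
  have hne := PlaneGraph.IsTriangle.ne_of_coe_eq ht h
  have hmem : ∀ x ∈ ({a, b, c} : Set Plane), x ∈ t := fun x hx => by rwa [← h] at hx
  exact hF t ht a (hmem a (by simp)) b (hmem b (by simp)) c (hmem c (by simp)) hne.1 hne.2.1 hne.2.2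

theorem IsFat.three_mul_le_pi (hF : M.IsFat δ) (ht : M.IsTriangle t) : 3 * δ ≤ Real.pi := by
  obtain ⟨a, b, c, h⟩ := PlaneGraph.IsTriangle.exists_coe_eq ht
  have h' : (t : Set Plane) = {b, c, a} := by rw [h, insert_comm, pair_comm a c]
  have h'' : (t : Set Plane) = {c, a, b} := by rw [h, pair_comm b c, insert_comm]
  have hsum := EuclideanGeometry.angle_add_angle_add_angle_eq_pi c
    (PlaneGraph.IsTriangle.ne_of_coe_eq ht h).1.symm
  linarith [hF.le_angle ht h, hF.le_angle ht h', hF.le_angle ht h'']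

/-- Directions `u` in which the triangle `abc`, or the adjacent triangle `bcd`, has a point that
is further out than both `a` and `b`. -/
def capArc (a b c d : Plane) : Set Plane :=
  {u | 0 < inner ℝ u (c - a) ∧ 0 < inner ℝ u (c - b)} ∪
    {u | 0 < inner ℝ u (b - c) ∧ 0 < inner ℝ u (d - b)}

theorem isOpen_capArc (a b c d : Plane) : IsOpen (capArc a b c d) :=
  (isOpen_wedge _ _).union (isOpen_wedge _ _)

/-- The first wedge has the opening angle `π - ∠ a c b`, which is the sum of the two other angles
of `abc`, and the second one the opening angle `∠ c b d`. -/
theorem IsFat.le_angular_capArc (hF : M.IsFat δ) (ht : M.IsTriangle t) (hs : M.IsTriangle s)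
    (h : (t : Set Plane) = {a, b, c}) (hd : (s : Set Plane) = {b, c, d}) :
    ENNReal.ofReal (3 * δ) ≤ angular (capArc a b c d) := by
  have hne := PlaneGraph.IsTriangle.ne_of_coe_eq ht h
  have hne' := PlaneGraph.IsTriangle.ne_of_coe_eq hs hd
  have h'' : (t : Set Plane) = {c, a, b} := by rw [h, pair_comm b c, insert_comm]
  have hd' : (s : Set Plane) = {c, b, d} := by rw [hd, insert_comm]
  have hdisj : Disjoint {u : Plane | 0 < inner ℝ u (c - a) ∧ 0 < inner ℝ u (c - b)}
      {u : Plane | 0 < inner ℝ u (b - c) ∧ 0 < inner ℝ u (d - b)} := by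
    refine disjoint_left.2 fun u hu hu' => ?_
    have h1 : 0 < inner ℝ u (c - b) := hu.2
    have h2 : 0 < inner ℝ u (b - c) := hu'.1
    rw [← neg_sub, inner_neg_right] at h2
    linarith
  rw [capArc, measure_union hdisj (isOpen_wedge _ _).measurableSet]
  have h1 := le_angular_wedge (sub_ne_zero.2 hne.2.2.symm) (sub_ne_zero.2 hne.2.1.symm)
  have h2 := le_angular_wedge (sub_ne_zero.2 hne'.1) (sub_ne_zero.2 hne'.2.2.symm)
  have e1 : InnerProductGeometry.angle (c - a) (c - b) = EuclideanGeometry.angle a c b := by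
    rw [EuclideanGeometry.angle, ← InnerProductGeometry.angle_neg_neg, neg_sub, neg_sub]; rfl
  have e2 : Real.pi - InnerProductGeometry.angle (b - c) (d - b) =
      EuclideanGeometry.angle c b d := by
    rw [EuclideanGeometry.angle, ← InnerProductGeometry.angle_neg_left, neg_sub]; rfl
  rw [e1] at h1
  rw [e2] at h2
  have hsum := EuclideanGeometry.angle_add_angle_add_angle_eq_pi c hne.1.symm
  rw [EuclideanGeometry.angle_comm b c a] at hsum
  have f1 := hF.le_angle ht h
  have f2 := hF.le_angle ht h''
  have f3 := hF.le_angle hs hd'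
  calc ENNReal.ofReal (3 * δ)
      ≤ ENNReal.ofReal ((Real.pi - EuclideanGeometry.angle a c b) +
          EuclideanGeometry.angle c b d) := ENNReal.ofReal_le_ofReal (by linarith)
    _ ≤ _ := ENNReal.ofReal_add_le.trans (add_le_add h1 h2)

theorem IsCap.exists_further (h : M.IsCap P t a b c) (hP : M.IsCarrot P)
    (hs : s ∈ M.trianglesIn P) (hd : (s : Set Plane) = {b, c, d}) (hneg : height b c a d < 0)
    {u : Plane} (hu : u ∈ capArc a b c d) :
    ∃ p ∈ P, 0 ≤ height a b c p ∧ inner ℝ u a < inner ℝ u p ∧ inner ℝ u b < inner ℝ u p := by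
  have hi := h.inscribed hP
  have hi' := hP.inscribed hs hd
  rcases hu with ⟨h1, h2⟩ | ⟨h1, h2⟩ <;> rw [inner_sub_right] at h1 h2
  · exact ⟨c, hi.mem₃, by rw [height_apex hi.orient_ne]; norm_num, by linarith, by linarith⟩
  · refine ⟨d, hi'.mem₃, hi.height_nonneg_of_beyond hP.convex h.side hi'.mem₃ hneg.le, ?_,
      by linarith⟩
    refine h.side.inner_lt hi' hP.convex hi'.mem₃ hi.mem₁ ?_ ?_ (by linarith) (by linarith)
    · rw [height_apex hi'.orient_ne]; norm_num
    · rw [height_inv]; exact (inv_lt_zero.2 hneg).le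

theorem IsMinCap.height_nonpos (h : M.IsMinCap P t a b c) (hP : M.IsCarrot P) {a' b' c' : Plane}
    (h' : M.IsMinCap P s a' b' c') (hst : s ≠ t) {x : Plane} (hx : x ∈ P)
    (hx' : 0 ≤ height a' b' c' x) : height a b c x ≤ 0 := by
  have hi := h.1.inscribed hP
  obtain ⟨z, -, -, hz3, hzP⟩ := exists_mem_interior_height_eq (h'.1.inscribed hP).orient_ne
  have hzs : z ∈ interior (convexHull ℝ (s : Set Plane)) := by
    rw [h'.1.coe_eq]
    exact hzP _ (convex_convexHull ℝ _) (subset_convexHull ℝ _ (by simp))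
      (subset_convexHull ℝ _ (by simp)) (subset_convexHull ℝ _ (by simp))
  have hnt : ∀ x ∈ ({a, b, c} : Set Plane), height a' b' c' x ≤ 0 := by
    intro x hx
    rw [← h.1.coe_eq] at hx
    exact height_nonpos_of_interior (convex_convexHull ℝ _)
      (PlaneGraph.IsTriangle.nonempty_interior h.1.mem.1)
      (fun y hy => h'.beyond hP h.1 hst.symm hy) (subset_convexHull ℝ _ hx)
  exact h.1.base.nested hi hP.convex
    (convexHull_subset_of_mem_trianglesIn hP h'.1.mem (interior_subset hzs))
    (h.beyond hP h'.1 hst hzs) (by rw [hz3]; norm_num) (hnt a (by simp)) (hnt b (by simp)) hx hx'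

/-- In a direction of the arc of a minimal cap, the cap has a point that is further out than
everything on the other side of its base, in particular than every other minimal cap. -/
theorem IsMinCap.disjoint_capArc (h : M.IsMinCap P t a b c) (hP : M.IsCarrot P)
    {a' b' c' d' : Plane} {t' s' : Finset Plane} (h' : M.IsMinCap P t' a' b' c') (htt : t' ≠ t)
    (hs : s ∈ M.trianglesIn P) (hd : (s : Set Plane) = {b, c, d}) (hneg : height b c a d < 0)
    (hs' : s' ∈ M.trianglesIn P) (hd' : (s' : Set Plane) = {b', c', d'})
    (hneg' : height b' c' a' d' < 0) : Disjoint (capArc a b c d) (capArc a' b' c' d') := by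
  refine disjoint_left.2 fun u hu hu' => ?_
  obtain ⟨p, hp, hp0, hpa, hpb⟩ := h.1.exists_further hP hs hd hneg hu
  obtain ⟨p', hp', hp0', hpa', hpb'⟩ := h'.1.exists_further hP hs' hd' hneg' hu'
  have h1 := h.1.base.inner_lt (h.1.inscribed hP) hP.convex hp hp' hp0
    (h.height_nonpos hP h' htt hp' hp0') hpa hpb
  have h2 := h'.1.base.inner_lt (h'.1.inscribed hP) hP.convex hp' hp hp0'
    (h'.height_nonpos hP h htt.symm hp hp0) hpa' hpb'
  exact lt_asymm h1 h2

/-- In a fat mesh the triangles of the minimal caps number at most `2π / (3δ)`. A triangle is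
added to them if there are none. -/
theorem IsCarrot.exists_generators (hP : M.IsCarrot P) (hδ : 0 < δ) (hF : M.IsFat δ) :
    ∃ G : Finset (Finset Plane), G.Nonempty ∧ G.card ≤ ⌊2 * Real.pi / (3 * δ)⌋₊ ∧
      (G : Set (Finset Plane)) ⊆ M.trianglesIn P ∧
      ∀ t a b c, M.IsMinCap P t a b c → t ∈ G := by
  classical
  set S : Set (Finset Plane) := {t | ∃ a b c, M.IsMinCap P t a b c} with hS
  have hsub : S ⊆ M.trianglesIn P := by
    rintro t ⟨a, b, c, h⟩
    exact h.1.mem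
  have hfin : S.Finite := (M.finite_trianglesIn P).subset hsub
  rcases S.eq_empty_or_nonempty with hem | hne
  · obtain ⟨t, ht⟩ := hP.exists_mem_trianglesIn
    refine ⟨{t}, by simp, ?_, by simpa using ht, fun t' a b c h => ?_⟩
    · rw [Finset.card_singleton]
      apply Nat.le_floor
      rw [Nat.cast_one, le_div_iff₀ (by positivity)]
      linarith [hF.three_mul_le_pi ht.1, Real.pi_pos]
    · have : t' ∈ S := ⟨a, b, c, h⟩
      rw [hem] at this
      exact absurd this (notMem_empty _)
  · refine ⟨hfin.toFinset, by simpa using hne, ?_, by simpa using hsub,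
      fun t a b c h => hfin.mem_toFinset.2 ⟨a, b, c, h⟩⟩
    have hex : ∀ t : Finset Plane, ∃ a b c d s, t ∈ S → M.IsMinCap P t a b c ∧
        s ∈ M.trianglesIn P ∧ (s : Set Plane) = {b, c, d} ∧ height b c a d < 0 := by
      intro t
      by_cases ht : t ∈ S
      · obtain ⟨a, b, c, h⟩ := id ht
        obtain ⟨s, hs, d, hd, hneg⟩ := hP.exists_adjacent h.1.mem
          (by rw [h.1.coe_eq, insert_comm, pair_comm a c]) h.1.side
        exact ⟨a, b, c, d, s, fun _ => ⟨h, hs, hd, hneg⟩⟩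
      · exact ⟨0, 0, 0, 0, ∅, fun h => absurd h ht⟩
    choose a b c d s hall using hex
    apply Nat.le_floor
    rw [le_div_iff₀ (by positivity)]
    refine card_mul_le_of_disjoint_arcs hfin.toFinset
      (fun t => capArc (a t) (b t) (c t) (d t)) (fun t _ => isOpen_capArc _ _ _ _)
      (fun t ht => ?_) fun t ht t' ht' hne => ?_
    · obtain ⟨h, hs, hd, -⟩ := hall t (hfin.mem_toFinset.1 ht)
      exact hF.le_angular_capArc h.1.mem.1 hs.1 h.1.coe_eq hd
    · obtain ⟨h, hs, hd, hn⟩ := hall t (hfin.mem_toFinset.1 ht)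
      obtain ⟨h', hs', hd', hn'⟩ := hall t' (hfin.mem_toFinset.1 ht')
      exact h.disjoint_capArc hP h' hne.symm hs hd hn hs' hd' hn'

end Mesh

end MeshCarrots

/-! ### Corners of the part spanned by the minimal caps -/

namespace MeshCarrots

/-- Rotation by a right angle. -/
noncomputable def perp (x : Plane) : Plane := !₂[-x 1, x 0]

theorem inner_perp (u x : Plane) : inner ℝ u (perp x) = orient 0 x u := by
  simp [perp, orient, PiLp.inner_apply, Fin.sum_univ_two]; ring

theorem angle_perp (x y : Plane) :
    InnerProductGeometry.angle (perp x) (perp y) = InnerProductGeometry.angle x y := by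
  have h1 : inner ℝ (perp x) (perp y) = inner ℝ x y := by
    simp [perp, PiLp.inner_apply, Fin.sum_univ_two]; ring
  have h2 : ∀ x : Plane, ‖perp x‖ = ‖x‖ := by
    intro x
    simp [perp, EuclideanSpace.norm_eq, Fin.sum_univ_two, add_comm]
  simp only [InnerProductGeometry.angle, h1, h2]

theorem perp_ne_zero {x : Plane} (h : x ≠ 0) : perp x ≠ 0 := by
  intro h0
  apply h
  have e0 := congrArg (fun z : Plane => z 0) h0
  have e1 := congrArg (fun z : Plane => z 1) h0
  simp only [perp, PiLp.zero_apply] at e0 e1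
  exact plane_ext (by simpa using e1) (by simpa using e0)

/-- The directions that point from the vertex `a` into the triangle `abc`, provided the triangle
is positively oriented. -/
def sector (a b c : Plane) : Set Plane :=
  {u | 0 < inner ℝ u (perp (b - a)) ∧ 0 < inner ℝ u (-perp (c - a))}

theorem le_angular_sector {a b c : Plane} (hb : b ≠ a) (hc : c ≠ a) :
    ENNReal.ofReal (EuclideanGeometry.angle b a c) ≤ angular (sector a b c) := by
  have h := le_angular_wedge (perp_ne_zero (sub_ne_zero.2 hb))
    (neg_ne_zero.2 (perp_ne_zero (sub_ne_zero.2 hc)))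
  rw [InnerProductGeometry.angle_neg_right, sub_sub_cancel, angle_perp] at h
  exact h

theorem eventually_mem_interior_of_mem_sector {a b c u : Plane} (h : 0 < orient a b c)
    (hu : u ∈ sector a b c) :
    ∀ᶠ ε in nhdsWithin (0 : ℝ) (Ioi 0), a + ε • u ∈ interior (convexHull ℝ {a, b, c}) := by
  obtain ⟨h1, h2⟩ := hu
  rw [inner_perp] at h1
  rw [inner_neg_right, inner_perp] at h2
  have hc : Continuous fun ε : ℝ => height b c a (a + ε • u) :=
    (continuous_height b c a).comp (by fun_prop)
  have h0 : ∀ᶠ ε in nhds (0 : ℝ), 0 < height b c a (a + ε • u) := by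
    refine hc.continuousAt.eventually (lt_mem_nhds ?_)
    simp [height_apex (show orient b c a ≠ 0 by rw [orient_rotate]; exact h.ne')]
  filter_upwards [nhdsWithin_le_nhds h0, self_mem_nhdsWithin] with ε hε hε0
  replace hε0 : 0 < ε := hε0
  refine mem_interior_of_height_pos (convex_convexHull ℝ _) h.ne'
    (subset_convexHull ℝ _ (by simp)) (subset_convexHull ℝ _ (by simp))
    (subset_convexHull ℝ _ (by simp)) hε ?_ ?_
  · have e : orient c a (a + ε • u) = ε * -orient 0 (c - a) u := by
      simp [orient]; ring
    rw [height, e, orient_rotate b c a, orient_rotate a b c]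
    exact div_pos (mul_pos hε0 h2) h
  · have e : orient a b (a + ε • u) = ε * orient 0 (b - a) u := by
      simp [orient]; ring
    rw [height, e]
    positivity

namespace Mesh

variable {M : Mesh} {s t : Finset Plane} {P H : Set Plane} {a b c d : Plane} {δ : ℝ}

open Classical in
/-- All triangles of the mesh. -/
noncomputable def triangles (M : Mesh) : Finset (Finset Plane) :=
  M.verts.powerset.filter fun t => M.IsTriangle t

theorem mem_triangles : t ∈ M.triangles ↔ M.IsTriangle t := by
  simp only [triangles, Finset.mem_filter, Finset.mem_powerset, and_iff_right_iff_imp]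
  exact fun h => PlaneGraph.IsTriangle.subset_verts h

/-- In a fat mesh the triangles at a vertex are bounded in number, since they have disjoint
sectors. -/
theorem IsFat.card_star_le (hF : M.IsFat δ) (hδ : 0 < δ) (v : Plane) (S : Finset (Finset Plane))
    (hS : ∀ t ∈ S, M.IsTriangle t ∧ v ∈ t) : S.card ≤ ⌊2 * Real.pi / δ⌋₊ := by
  have hex : ∀ t : Finset Plane, ∃ b c, t ∈ S →
      (t : Set Plane) = {v, b, c} ∧ 0 < orient v b c := by
    intro t
    by_cases ht : t ∈ S
    · obtain ⟨p, q, r, h⟩ := PlaneGraph.IsTriangle.exists_coe_eq (hS t ht).1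
      have h1 : ∃ b c, (t : Set Plane) = {v, b, c} := by
        have hv : v ∈ ({p, q, r} : Set Plane) := h ▸ (hS t ht).2
        rcases hv with rfl | rfl | rfl
        · exact ⟨q, r, h⟩
        · exact ⟨p, r, by rw [h, insert_comm]⟩
        · exact ⟨p, q, by rw [h, pair_comm q, insert_comm]⟩
      obtain ⟨b, c, hbc⟩ := h1
      rcases (PlaneGraph.IsTriangle.orient_ne (hS t ht).1 hbc).lt_or_gt with ho | ho
      · refine ⟨c, b, fun _ => ⟨by rw [hbc, pair_comm], ?_⟩⟩
        rw [← orient_rotate, orient_swap, orient_rotate]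
        linarith
      · exact ⟨b, c, fun _ => ⟨hbc, ho⟩⟩
    · exact ⟨0, 0, fun h => absurd h ht⟩
  choose b c hbc using hex
  apply Nat.le_floor
  rw [le_div_iff₀ hδ]
  refine card_mul_le_of_disjoint_arcs S (fun t => sector v (b t) (c t))
    (fun t _ => isOpen_wedge _ _) (fun t ht => ?_) fun t ht t' ht' hne => ?_
  · obtain ⟨h, -⟩ := hbc t ht
    have hn := PlaneGraph.IsTriangle.ne_of_coe_eq (hS t ht).1 h
    have ha := hF.le_angle (hS t ht).1 (show (t : Set Plane) = {b t, v, c t} by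
      rw [insert_comm, ← h])
    exact (ENNReal.ofReal_le_ofReal ha).trans (le_angular_sector hn.1.symm hn.2.2.symm)
  · refine disjoint_left.2 fun u hu hu' => ?_
    have h1 := eventually_mem_interior_of_mem_sector (hbc t ht).2 hu
    have h2 := eventually_mem_interior_of_mem_sector (hbc t' ht').2 hu'
    obtain ⟨ε, hε1, hε2⟩ := (h1.and h2).exists
    rw [← (hbc t ht).1] at hε1
    rw [← (hbc t' ht').1] at hε2
    exact disjoint_left.1 (disjoint_interior_triangles (hS t ht).1 (hS t' ht').1 hne) hε1 hε2

open Classical in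
theorem IsFat.card_triangles_le (hF : M.IsFat δ) (hδ : 0 < δ) :
    M.triangles.card ≤ M.size * ⌊2 * Real.pi / δ⌋₊ := by
  have hsub : M.triangles ⊆
      M.verts.biUnion fun v => M.triangles.filter fun t => v ∈ t := by
    intro t ht
    have h := mem_triangles.1 ht
    obtain ⟨a, b, c, habc⟩ := PlaneGraph.IsTriangle.exists_coe_eq h
    have ha : a ∈ t := by rw [← Finset.mem_coe, habc]; simp
    exact Finset.mem_biUnion.2 ⟨a, PlaneGraph.IsTriangle.subset_verts h ha,
      Finset.mem_filter.2 ⟨ht, ha⟩⟩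
  refine (Finset.card_le_card hsub).trans (Finset.card_biUnion_le_card_mul _ _ _ fun v _ => ?_)
  refine hF.card_star_le hδ v _ fun t ht => ?_
  rw [Finset.mem_filter, mem_triangles] at ht
  exact ht

/-- `a` is a vertex of the mesh in `H` and, in the directions of the arc between the outer normals
of the sides `ab` and `ac` of some triangle `abc` of the mesh, it is the extreme point of `H`. -/
def IsCorner (M : Mesh) (H : Set Plane) (a : Plane) : Prop :=
  a ∈ M.verts ∧ a ∈ H ∧ ∃ t b c, M.IsTriangle t ∧ (t : Set Plane) = {a, b, c} ∧
    ∀ u : Plane, 0 < inner ℝ u (a - b) → 0 < inner ℝ u (c - a) →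
      ∀ p ∈ H, p ≠ a → inner ℝ u p < inner ℝ u a

theorem IsFat.card_corners_le (hF : M.IsFat δ) (hδ : 0 < δ) (S : Finset Plane)
    (hS : ∀ a ∈ S, M.IsCorner H a) : S.card ≤ ⌊2 * Real.pi / δ⌋₊ := by
  have hex : ∀ a : Plane, ∃ t b c, a ∈ S → M.IsTriangle t ∧ (t : Set Plane) = {a, b, c} ∧
      ∀ u : Plane, 0 < inner ℝ u (a - b) → 0 < inner ℝ u (c - a) →
        ∀ p ∈ H, p ≠ a → inner ℝ u p < inner ℝ u a := by
    intro a
    by_cases ha : a ∈ S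
    · obtain ⟨t, b, c, h⟩ := (hS a ha).2.2
      exact ⟨t, b, c, fun _ => h⟩
    · exact ⟨∅, 0, 0, fun h => absurd h ha⟩
  choose t b c hall using hex
  apply Nat.le_floor
  rw [le_div_iff₀ hδ]
  refine card_mul_le_of_disjoint_arcs S
    (fun a => {u | 0 < inner ℝ u (a - b a) ∧ 0 < inner ℝ u (c a - a)})
    (fun t _ => isOpen_wedge _ _) (fun a ha => ?_) fun a ha a' ha' hne => ?_
  · obtain ⟨ht, h, -⟩ := hall a ha
    have hn := PlaneGraph.IsTriangle.ne_of_coe_eq ht h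
    have hle := hF.le_angle ht (show ((t a : Finset Plane) : Set Plane) = {b a, a, c a} by
      rw [insert_comm, ← h])
    have hw := le_angular_wedge (sub_ne_zero.2 hn.1) (sub_ne_zero.2 hn.2.2.symm)
    rw [← InnerProductGeometry.angle_neg_left, neg_sub] at hw
    exact (ENNReal.ofReal_le_ofReal hle).trans hw
  · refine disjoint_left.2 fun u hu hu' => ?_
    have h1 := (hall a ha).2.2 u hu.1 hu.2 a' (hS a' ha').2.1 hne.symm
    have h2 := (hall a' ha').2.2 u hu'.1 hu'.2 a (hS a ha).2.1 hne
    exact lt_asymm h1 h2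

open Classical in
/-- The triangles of the mesh that have a vertex which is a corner of `H`. -/
noncomputable def cornerTriangles (M : Mesh) (H : Set Plane) : Finset (Finset Plane) :=
  M.triangles.filter fun t => ∃ a ∈ t, M.IsCorner H a

open Classical in
theorem IsFat.card_cornerTriangles_le (hF : M.IsFat δ) (hδ : 0 < δ) (H : Set Plane) :
    (M.cornerTriangles H).card ≤ ⌊2 * Real.pi / δ⌋₊ * ⌊2 * Real.pi / δ⌋₊ := by
  have hsub : M.cornerTriangles H ⊆
      (M.verts.filter fun a => M.IsCorner H a).biUnion
        fun v => M.triangles.filter fun t => v ∈ t := by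
    intro t ht
    obtain ⟨h, a, ha, hc⟩ := Finset.mem_filter.1 ht
    exact Finset.mem_biUnion.2 ⟨a, Finset.mem_filter.2 ⟨hc.1, hc⟩, Finset.mem_filter.2 ⟨h, ha⟩⟩
  refine (Finset.card_le_card hsub).trans
    ((Finset.card_biUnion_le_card_mul _ _ _ fun v _ => ?_).trans (Nat.mul_le_mul_right _ ?_))
  · refine hF.card_star_le hδ v _ fun t ht => ?_
    rw [Finset.mem_filter, mem_triangles] at ht
    exact ht
  · exact hF.card_corners_le hδ _ fun a ha => (Finset.mem_filter.1 ha).2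

/-- A convex part `H` of a carrot that contains the triangles of all minimal caps, and no part of a
mesh triangle without containing it all, contains the triangles of all caps: a cap triangle outside
`H` would give a cap away from `H`, which contains a minimal one. -/
theorem IsCarrot.not_isCap (hP : M.IsCarrot P) (hH : Convex ℝ H) (hHP : H ⊆ P)
    (hne : (interior H).Nonempty)
    (hd : ∀ t, M.IsTriangle t → (t : Set Plane) ⊆ H ∨
      Disjoint (interior H) (interior (convexHull ℝ (t : Set Plane))))
    (hmin : ∀ t a b c, M.IsMinCap P t a b c → (t : Set Plane) ⊆ H)
    (htH : ¬ (t : Set Plane) ⊆ H) : ¬ M.IsCap P t a b c := by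
  intro h
  obtain ⟨p, q, r, ht, he, hn⟩ := hP.exists_beyond h.mem hH hHP hne
    ((hd t h.mem.1).resolve_left htH)
  have hex : ∃ t' a' b' c', M.IsMinCap P t' a' b' c' ∧
      M.capTriangles P a' b' c' ⊆ M.capTriangles P p q r := by
    rcases h.reorder ht he with hc | hc
    · exact hc.exists_isMinCap_subset
    · rw [← capTriangles_swap]
      exact hc.exists_isMinCap_subset
  obtain ⟨t', a', b', c', h', hsub⟩ := hex
  have hmem : t' ∈ M.capTriangles P a' b' c' := by
    refine ⟨h'.1.mem, fun x hx => ?_⟩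
    rw [← Finset.mem_coe, h'.1.coe_eq] at hx
    rcases hx with rfl | rfl | rfl
    · rw [height_left]
    · rw [height_right]
    · rw [height_apex (h'.1.inscribed hP).orient_ne]; norm_num
  obtain ⟨y, hy⟩ := PlaneGraph.IsTriangle.nonempty_interior h'.1.mem.1
  have hyH := interior_mono (convexHull_min (hmin _ _ _ _ h') hH) hy
  have hy0 : y ∈ {x | height p q r x ∈ Ici 0} :=
    convexHull_min (fun x hx => (hsub hmem).2 x hx) (convex_height_mem _ _ _ (convex_Ici 0))
      (interior_subset hy)
  exact absurd (hn y hyH) (not_lt.2 hy0)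

/-- If `H` lies in `P` beyond the side `ab` of an inscribed triangle `abc`, then `a` is the extreme
point of `H` in all directions between the outer normals of the sides `ab` and `ac`. -/
theorem inner_lt_of_beyond (hi : Inscribed P a b c) (hP : Convex ℝ P) (hH : Convex ℝ H)
    (hHP : H ⊆ P) (hne : (interior H).Nonempty) (hn : ∀ x ∈ interior H, height a b c x < 0)
    {u p : Plane} (hu : 0 < inner ℝ u (a - b)) (hu' : 0 < inner ℝ u (c - a)) (hp : p ∈ H)
    (hpa : p ≠ a) : inner ℝ u p < inner ℝ u a := by
  have hp0 : height a b c p ≤ 0 := height_nonpos_of_interior hH hne hn hp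
  have hp1 : 0 ≤ height c a b p := by
    by_contra! hcon
    obtain ⟨k, hk⟩ := hne
    -- a point of `H` near `p` would have two negative barycentric coordinates
    have hopen : IsOpen {x | height c a b x < 0} :=
      isOpen_lt (continuous_height _ _ _) continuous_const
    obtain ⟨s, s0, s1, hs⟩ := exists_comb_mem_of_isOpen hopen hcon k
    have hmem : (1 - s) • p + s • k ∈ H :=
      hH hp (interior_subset hk) (by linarith) s0.le (by ring)
    refine hi.rotate.not_two_neg hP (hHP hmem) hs ?_
    rw [height_comb _ _ _ _ _ (by ring)]
    have := mul_neg_of_pos_of_neg s0 (hn k hk)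
    have := mul_nonpos_of_nonneg_of_nonpos (show 0 ≤ 1 - s by linarith) hp0
    linarith
  have e := sub_eq_barycentric hi.orient_ne p
  have e' := congrArg (fun z => inner ℝ u z) e
  simp only [inner_add_right, inner_smul_right] at e'
  rw [inner_sub_right u p a] at e'
  rw [← neg_sub, inner_neg_right] at hu
  by_contra! hcon
  have h1 := mul_nonpos_of_nonneg_of_nonpos hp1 (by linarith : inner ℝ u (b - a) ≤ 0)
  have h2 := mul_nonpos_of_nonpos_of_nonneg hp0 hu'.le
  have z1 : height c a b p = 0 :=
    (mul_eq_zero.1 (by linarith : height c a b p * inner ℝ u (b - a) = 0)).resolve_right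
      (by linarith)
  have z2 : height a b c p = 0 :=
    (mul_eq_zero.1 (by linarith : height a b c p * inner ℝ u (c - a) = 0)).resolve_right hu'.ne'
  rw [z1, z2, zero_smul, zero_smul, add_zero] at e
  exact hpa (sub_eq_zero.1 e)

/-- Under the same assumptions, the triangles of the carrot outside `H` sit at corners of `H`:
the neighbour of such a triangle is in `H`, as otherwise it would have two interior edges. -/
theorem IsCarrot.exists_isCorner (hP : M.IsCarrot P) (hH : Convex ℝ H) (hHP : H ⊆ P)
    (hne : (interior H).Nonempty)
    (hd : ∀ t, M.IsTriangle t → (t : Set Plane) ⊆ H ∨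
      Disjoint (interior H) (interior (convexHull ℝ (t : Set Plane))))
    (hmin : ∀ t a b c, M.IsMinCap P t a b c → (t : Set Plane) ⊆ H)
    (ht : t ∈ M.trianglesIn P) (htH : ¬ (t : Set Plane) ⊆ H) : ∃ a ∈ t, M.IsCorner H a := by
  obtain ⟨p, q, r, hpqr, he, hn⟩ := hP.exists_beyond ht hH hHP hne ((hd t ht.1).resolve_left htH)
  have hpt : p ∈ t := by rw [← Finset.mem_coe, hpqr]; simp
  have hi := hP.inscribed ht hpqr
  obtain ⟨s, hs, d, hsd, hdn⟩ := hP.exists_adjacent ht hpqr he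
  have hsH : (s : Set Plane) ⊆ H := by
    by_contra hsH
    have hcap := fun a b c => hP.not_isCap hH hHP hne hd hmin hsH (a := a) (b := b) (c := c)
    obtain ⟨p', q', r', hs', he', hn'⟩ := hP.exists_beyond hs hH hHP hne
      ((hd s hs.1).resolve_left hsH)
    have hne1 := PlaneGraph.IsTriangle.ne_of_coe_eq hs.1 hs'
    have hmem : ∀ x ∈ ({p', q', r'} : Set Plane), x = p ∨ x = q ∨ x = d := by
      rw [← hs', hsd]; exact fun x hx => hx
    -- the edge `p'q'` would be `pq`, as `s` has only one interior edge
    have hbad : ¬ ∀ x ∈ interior H, height p q d x < 0 := by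
      intro hn2
      obtain ⟨k, hk⟩ := hne
      have h1 := hn k hk
      have h2 := hn2 k hk
      have e : height p q d k = height p q r k / height p q r d := by
        simp only [height]; rw [div_div_div_cancel_right₀ hi.orient_ne]
      rw [e] at h2
      exact absurd (div_pos_of_neg_of_neg h1 hdn) h2.le.not_gt
    have hqd : ¬ InteriorEdge P q d := fun h => hcap p q d ⟨hs, hsd, he, h⟩
    have hpd : ¬ InteriorEdge P p d := fun h =>
      hcap q p d ⟨hs, by rw [hsd, insert_comm], he.symm, h⟩
    have hr' : r' = d := by
      rcases hmem p' (by simp) with hp' | hp' | hp' <;>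
      rcases hmem q' (by simp) with hq' | hq' | hq' <;>
      rcases hmem r' (by simp) with hr' | hr' | hr' <;> subst hp' hq' hr' <;>
      first
      | rfl
      | exact absurd rfl hne1.1
      | exact absurd rfl hne1.2.1
      | exact absurd rfl hne1.2.2
      | exact absurd he' hqd
      | exact absurd he'.symm hqd
      | exact absurd he' hpd
      | exact absurd he'.symm hpd
    subst hr'
    rcases hmem p' (by simp) with rfl | rfl | rfl
    · rcases hmem q' (by simp) with rfl | rfl | rfl
      exacts [hne1.1 rfl, hbad hn', hne1.2.1 rfl]
    · rcases hmem q' (by simp) with rfl | rfl | rfl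
      · exact hbad fun x hx => by rw [height_swap]; exact hn' x hx
      exacts [hne1.1 rfl, hne1.2.1 rfl]
    · exact hne1.2.2 rfl
  refine ⟨p, hpt, PlaneGraph.IsTriangle.subset_verts ht.1 hpt, hsH (by rw [hsd]; simp),
    t, q, r, ht.1, hpqr, fun u hu hu' x hx hxp =>
      inner_lt_of_beyond hi hP.convex hH hHP hne hn hu hu' hx hxp⟩

end Mesh

end MeshCarrots

/-! ### Counting carrots -/

namespace MeshCarrots

namespace Mesh

variable {M : Mesh} {s t : Finset Plane} {P P' H : Set Plane} {δ : ℝ}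

/-- The intersection of all carrots that contain given triangles. -/
def carrotHull (M : Mesh) {k : ℕ} (g : Fin k → Finset Plane) : Set Plane :=
  ⋂₀ {P | M.IsCarrot P ∧ ∀ i, (g i : Set Plane) ⊆ P}

theorem convex_carrotHull (M : Mesh) {k : ℕ} (g : Fin k → Finset Plane) :
    Convex ℝ (M.carrotHull g) :=
  convex_sInter fun _ h => h.1.convex

theorem subset_carrotHull (M : Mesh) {k : ℕ} (g : Fin k → Finset Plane) (i : Fin k) :
    (g i : Set Plane) ⊆ M.carrotHull g :=
  subset_sInter fun _ h => h.2 i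

theorem subset_carrotHull_or_disjoint (M : Mesh) {k : ℕ} (g : Fin k → Finset Plane)
    (ht : M.IsTriangle t) : (t : Set Plane) ⊆ M.carrotHull g ∨
      Disjoint (interior (M.carrotHull g)) (interior (convexHull ℝ (t : Set Plane))) := by
  by_contra! hcon
  obtain ⟨h1, h2⟩ := hcon
  obtain ⟨x, hx, hxt⟩ := not_disjoint_iff.1 h2
  exact h1 (subset_sInter fun Q hQ => hQ.1.subset_of_overlap ht
    ⟨x, hxt, interior_mono (sInter_subset_of_mem hQ) hx⟩)

/-- The triangles `g i` lie in `P`, there is at least one of them, and the triangles of all minimal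
caps of `P` are among them. -/
def Generates (M : Mesh) (P : Set Plane) {k : ℕ} (g : Fin k → Finset Plane) : Prop :=
  0 < k ∧ (∀ i, g i ∈ M.trianglesIn P) ∧ ∀ t a b c, M.IsMinCap P t a b c → ∃ i, g i = t

theorem IsCarrot.exists_generates (hP : M.IsCarrot P) (hδ : 0 < δ) (hF : M.IsFat δ) :
    ∃ g : Fin ⌊2 * Real.pi / (3 * δ)⌋₊ → Finset Plane, M.Generates P g := by
  obtain ⟨G, hne, hcard, hsub, hmin⟩ := hP.exists_generators hδ hF
  have : Nonempty G := hne.to_subtype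
  obtain ⟨e⟩ : Nonempty (G ↪ Fin ⌊2 * Real.pi / (3 * δ)⌋₊) := by
    rw [Function.Embedding.nonempty_iff_card_le]
    simpa using hcard
  refine ⟨fun i => (Function.invFun e i : G), (Finset.card_pos.2 hne).trans_le hcard,
    fun i => hsub (Function.invFun e i).2, fun t a b c h => ?_⟩
  exact ⟨e ⟨t, hmin t a b c h⟩,
    congrArg Subtype.val (Function.leftInverse_invFun e.injective ⟨t, hmin t a b c h⟩)⟩

theorem Generates.carrotHull_subset {k : ℕ} {g : Fin k → Finset Plane} (hP : M.IsCarrot P)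
    (hg : M.Generates P g) : M.carrotHull g ⊆ P :=
  sInter_subset_of_mem ⟨hP, fun i => (hg.2.1 i).2⟩

theorem Generates.exists_isCorner {k : ℕ} {g : Fin k → Finset Plane} (hP : M.IsCarrot P)
    (hg : M.Generates P g) (ht : t ∈ M.trianglesIn P) (htH : ¬ (t : Set Plane) ⊆ M.carrotHull g) :
    ∃ a ∈ t, M.IsCorner (M.carrotHull g) a := by
  refine hP.exists_isCorner (M.convex_carrotHull g) (hg.carrotHull_subset hP) ?_
    (fun _ h => M.subset_carrotHull_or_disjoint g h) (fun t a b c h => ?_) ht htH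
  · exact (PlaneGraph.IsTriangle.nonempty_interior (hg.2.1 ⟨0, hg.1⟩).1).mono
      (interior_mono (convexHull_min (M.subset_carrotHull g _) (M.convex_carrotHull g)))
  · obtain ⟨i, rfl⟩ := hg.2.2 t a b c h
    exact M.subset_carrotHull g i

theorem IsCarrot.eq_of_trianglesIn_eq (hP : M.IsCarrot P) (hP' : M.IsCarrot P')
    (h : M.trianglesIn P = M.trianglesIn P') : P = P' := by
  rw [hP.eq_iUnion, hP'.eq_iUnion, h]

theorem finite_carrots (M : Mesh) : {P : Set Plane | M.IsCarrot P}.Finite := by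
  refine Finite.of_finite_image (f := M.trianglesIn) ?_
    fun P hP P' hP' h => IsCarrot.eq_of_trianglesIn_eq hP hP' h
  refine (M.triangles.finite_toSet.finite_subsets).subset ?_
  rintro _ ⟨P, -, rfl⟩ t ht
  exact mem_triangles.2 ht.1

open Classical in
/-- Carrots with the same generators differ only in the triangles at the corners of the hull of
the generators, and there is a bounded number of those. -/
theorem IsFat.card_generated_le (hF : M.IsFat δ) (hδ : 0 < δ) {k : ℕ} (g : Fin k → Finset Plane)
    (S : Finset (Set Plane)) (hS : ∀ P ∈ S, M.IsCarrot P ∧ M.Generates P g) :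
    S.card ≤ 2 ^ (⌊2 * Real.pi / δ⌋₊ * ⌊2 * Real.pi / δ⌋₊) := by
  set H := M.carrotHull g with hH
  calc S.card ≤ (M.cornerTriangles H).powerset.card := by
        refine Finset.card_le_card_of_injOn
          (fun P => (M.cornerTriangles H).filter fun t : Finset Plane => (t : Set Plane) ⊆ P)
          (fun P _ => Finset.mem_coe.2 (Finset.mem_powerset.2 (Finset.filter_subset _ _)))
          fun P hPS P' hPS' heq => ?_
        obtain ⟨hP, hg⟩ := hS P hPS
        obtain ⟨hP', hg'⟩ := hS P' hPS'
        have key : ∀ {P P' : Set Plane}, M.IsCarrot P → M.Generates P g → M.Generates P' g →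
            M.IsCarrot P' →
            ((M.cornerTriangles H).filter fun t : Finset Plane => (t : Set Plane) ⊆ P) =
              ((M.cornerTriangles H).filter fun t : Finset Plane => (t : Set Plane) ⊆ P') →
            M.trianglesIn P ⊆ M.trianglesIn P' := by
          intro P P' hP hg hg' hP' heq t ht
          by_cases htH : (t : Set Plane) ⊆ H
          · exact ⟨ht.1, htH.trans (hg'.carrotHull_subset hP')⟩
          · have hc : t ∈ (M.cornerTriangles H).filter
                fun t : Finset Plane => (t : Set Plane) ⊆ P :=
              Finset.mem_filter.2 ⟨Finset.mem_filter.2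
                ⟨mem_triangles.2 ht.1, hg.exists_isCorner hP ht htH⟩, ht.2⟩
            rw [heq] at hc
            exact ⟨ht.1, (Finset.mem_filter.1 hc).2⟩
        exact hP.eq_of_trianglesIn_eq hP'
          (Subset.antisymm (key hP hg hg' hP' heq) (key hP' hg' hg hP heq.symm))
    _ = 2 ^ (M.cornerTriangles H).card := Finset.card_powerset _
    _ ≤ _ := Nat.pow_le_pow_right (by norm_num) (hF.card_cornerTriangles_le hδ H)

open Classical in
theorem IsFat.ncard_carrots_le (hF : M.IsFat δ) (hδ : 0 < δ) :
    {P : Set Plane | M.IsCarrot P}.ncard ≤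
      2 ^ (⌊2 * Real.pi / δ⌋₊ * ⌊2 * Real.pi / δ⌋₊) *
        (M.size * ⌊2 * Real.pi / δ⌋₊) ^ ⌊2 * Real.pi / (3 * δ)⌋₊ := by
  have hex : ∀ P : Set Plane, ∃ g : Fin ⌊2 * Real.pi / (3 * δ)⌋₊ → Finset Plane,
      M.IsCarrot P → M.Generates P g := by
    intro P
    by_cases hP : M.IsCarrot P
    · obtain ⟨g, hg⟩ := hP.exists_generates hδ hF
      exact ⟨g, fun _ => hg⟩
    · exact ⟨fun _ => ∅, fun h => absurd h hP⟩
  choose g hg using hex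
  rw [ncard_eq_toFinset_card _ M.finite_carrots]
  refine (Finset.card_le_mul_card_image_of_maps_to (f := g)
    (t := Fintype.piFinset fun _ => M.triangles) (fun P hP => ?_)
    (2 ^ (⌊2 * Real.pi / δ⌋₊ * ⌊2 * Real.pi / δ⌋₊)) fun f _ => ?_).trans ?_
  · exact Fintype.mem_piFinset.2 fun i =>
      mem_triangles.2 ((hg P (M.finite_carrots.mem_toFinset.1 hP)).2.1 i).1
  · refine hF.card_generated_le hδ f _ fun P hP => ?_
    have hP' := M.finite_carrots.mem_toFinset.1 (Finset.mem_filter.1 hP).1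
    exact ⟨hP', (Finset.mem_filter.1 hP).2 ▸ hg P hP'⟩
  · refine Nat.mul_le_mul_left _ ?_
    rw [Fintype.card_piFinset_const]
    exact Nat.pow_le_pow_left (hF.card_triangles_le hδ) _

end Mesh

end MeshCarrots

theorem mainTheorem6 (δ : ℝ) (hδ : 0 < δ) :
    ∃ C : ℝ, ∀ M : MeshCarrots.Mesh, M.IsFat δ →
      {P : Set MeshCarrots.Plane | M.IsCarrot P}.Finite ∧
        ({P : Set MeshCarrots.Plane | M.IsCarrot P}.ncard : ℝ) ≤
          C * (M.size : ℝ) ^ ⌊2 * Real.pi / (3 * δ)⌋₊ := by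
  refine ⟨2 ^ (⌊2 * Real.pi / δ⌋₊ * ⌊2 * Real.pi / δ⌋₊) *
    (⌊2 * Real.pi / δ⌋₊ : ℝ) ^ ⌊2 * Real.pi / (3 * δ)⌋₊, fun M hF => ⟨M.finite_carrots, ?_⟩⟩
  have h : ({P : Set MeshCarrots.Plane | M.IsCarrot P}.ncard : ℝ) ≤ _ :=
    Nat.cast_le.2 (hF.ncard_carrots_le hδ)
  refine h.trans_eq ?_
  push_cast
  rw [mul_pow]
  ring
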